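/- **Setting.** Energies are non-negative integers. Let $\mathcal X,\mathcal Y$ be finite alphabets with a zero symbol $0\in\mathcal X$, let $p(y|x)$ be a discrete memoryless channel, $\gamma:\mathcal X\to\{0,1,2,\dots\}$ a cost function with $\gamma(0)=0$, $\overline B\ge 0$ an integer (the battery capacity), $\mathcal E_B=\{0,\dots,\overline B\}$, $\mathcal E_H$ a finite set of non-negative integers, and $S:\mathcal E_B\times\mathcal E_H\to\{0,1,2,\dots\}$ a function that is non-decreasing in its first argument; $\mathcal S$ denotes its range. The initial battery level $B_1\in\mathcal E_B$ is a random variable and the harvested energies $\{E_n\}_{n\ge1}$ are an $\mathcal E_H$-valued random process independent of $B_1$. Inputs $x_1,\dots,x_N$ satisfy the energy constraint for $b_1$ and $e^N=(e_1,\dots,e_N)$ if, with $s_n=S(b_n,e_n)$ and $b_{n+1}=\min\{s_n-\gamma(x_n),\overline B\}$, one has $\gamma(x_n)\le s_n$ for all $1\le n\le N$. In the channel EH-SC2 the transmitter knows $B_1$ and, before the $n$-th transmission, $E_1,\dots,E_n$; the receiver knows only $Y^N$. Let $\mathcal U^{(N)}$ be the set of all $u^N=(u_1,\dots,u_N)$,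 $u_n:\mathcal E_B\times\mathcal E_H^n\to\mathcal X$, such that the inputs $x_n=u_n(b_1,e^n)$ satisfy the energy constraint for all $b_1\in\mathcal E_B$ and $e^N\in\mathcal E_H^N$. A code with $M$ messages and block length $N$ consists of an encoder $\{1,\dots,M\}\to\mathcal U^{(N)}$ and a decoder $\mathcal Y^N\to\{1,\dots,M\}$. With logarithms to the base $e$, a rate $R$ is achievable if there are codes with $\lceil e^{NR}\rceil$ messages whose maximal error probability tends to $0$ as $N\to\infty$; the capacity is the supremum of the achievable rates. Assume that $\{E_n\}_{n\ge1}$ is a homogeneous Markov process of order $r\ge0$ with transition probabilities $p(e\,|\,e^{-r})$, $e\in\mathcal E_H$, $e^{-r}=(e_{-r+1},\dots,e_0)\in\mathcal E_H^r$ (not necessarily stationary; the law of the first $r$ values is arbitrary). Set $$\overline C_N=\max_{P_{U^N}}\max_{e^{-r}\in\mathcal E_H^r}\frac1N\, I(U^N;Y^N\,|\,E^N,B_1=\overline B,e^{-r}),$$ where $P_{U^N}$ ranges over the probability distributions on $\mathcal U^{(N)}$ and, given $B_1=\overline B$ and the history $e^{-r}$, $U^N$ and $E^N$ are independent, $E^N$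 has the law $p(e^N|e^{-r})$ of the Markov process started from $e^{-r}$, and $Y_n\sim p(\cdot\,|\,X_n)$ with $X_n=U_n(\overline B,E^n)$. Let $Z_n=(E_{n-r+1}^n,S_n)\in\mathcal Z=\mathcal E_H^r\times\mathcal S$ be the overall state. Given $X_n=x$ and $Z_n=(h,s)$, the triple $(Y_n,E_{n+1},Z_{n+1})$ has the law under which $Y_n\sim p(\cdot|x)$ and $E_{n+1}\sim p(\cdot|h)$ are independent and $Z_{n+1}$ is formed by the last $r$ entries of $(h,E_{n+1})$ and $S_{n+1}=S(\min\{s-\gamma(x),\overline B\},E_{n+1})$. Let $\mathcal P^*$ be the set of all families $p(\cdot|z)$, $z\in\mathcal Z$, of probability distributions on $\mathcal X$ such that $p(\cdot|z)$ is supported on $\{x:\gamma(x)\le s\}$ for $z=(h,s)$. For a distribution $\pi$ on $\mathcal Z$ put $$\tilde c_N(\pi)=\max_{\{p_n\}_{n=1}^N\subset\mathcal P^*}\ \sum_{n=1}^N I(Y_nE_{n+1}Z_{n+1};X_n\,|\,Z_n)\Big|_{Z_1\sim\pi},$$ where $X_n$ has the conditional law $p_n(\cdot|Z_n)$ given the past.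 Let $\pi_{\overline B,e^{-r}}$ be the law of $Z_1$ given $B_1=\overline B$ and the history $e^{-r}$, that is, the law of the pair consisting of the last $r$ entries of $(e^{-r},E_1)$ and of $S(\overline B,E_1)$, where $E_1\sim p(\cdot|e^{-r})$. Finally, put $$\tilde C_N=\frac1N\max_{e^{-r}\in\mathcal E_H^r}\tilde c_N\big(\pi_{\overline B,e^{-r}}\big).$$ **Theorem.** For every $N\ge1$ the maxima that define $\overline C_N$ and $\tilde c_N(\pi)$ (for every distribution $\pi$ on $\mathcal Z$) are attained, $\tilde C_N\ge\overline C_N$, and $\tilde C_N$ is an upper bound for the capacity of EH-SC2. -/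

import Mathlib

open MeasureTheory ProbabilityTheory Filter

/-! ### Finite probability: events and conditional mutual information -/

open Classical in
/-- The probability of the event `A` under the mass function `μ` on a finite sample space. -/
noncomputable def finProb {T : Type*} [Fintype T] (μ : T → ℝ) (A : T → Prop) : ℝ :=
  ∑ t with A t, μ t

/-- The conditional mutual information `I(A; B | C)`, in nats, of three random variables on a finite
sample space with mass function `μ`, that is, the expectation of
`log (p(a,b,c) p(c) / (p(a,c) p(b,c)))`. Sample points of mass zero contribute zero, and at the
others all four probabilities are positive. -/
noncomputable def condMutualInfo {T α β δ : Type*} [Fintype T] (μ : T → ℝ)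
    (A : T → α) (B : T → β) (C : T → δ) : ℝ :=
  ∑ t, μ t * Real.log
    (finProb μ (fun t' => A t' = A t ∧ B t' = B t ∧ C t' = C t) * finProb μ (fun t' => C t' = C t) /
      (finProb μ (fun t' => A t' = A t ∧ C t' = C t) *
        finProb μ (fun t' => B t' = B t ∧ C t' = C t)))

/-! ### The energy harvesting channel

All sequences are indexed from `0`, so `e n`, `x n`, `y n` stand for the `(n+1)`-st symbols. -/

/-- The data of a finite discrete energy harvesting channel with input alphabet `𝒳` (containing a
zero symbol) and output alphabet `𝒴`; energies are natural numbers. -/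
structure EHChannel (𝒳 𝒴 : Type*) [Zero 𝒳] [Fintype 𝒴] where
  /-- the battery capacity -/
  Bmax : ℕ
  /-- the finite set of possible harvested energies -/
  harvest : Finset ℕ
  /-- the total energy `S(b, e)` available from battery level `b` and harvested energy `e` -/
  S : Fin (Bmax + 1) → harvest → ℕ
  /-- the energy cost of the input symbols -/
  cost : 𝒳 → ℕ
  cost_zero : cost 0 = 0
  /-- `W x y` is the transition probability `p(y | x)` of the discrete memoryless channel -/
  W : 𝒳 → 𝒴 → ℝ
  W_mem : ∀ x, W x ∈ stdSimplex ℝ 𝒴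

namespace EHChannel

variable {𝒳 𝒴 : Type*} [Zero 𝒳] [Fintype 𝒳] [Fintype 𝒴] (ch : EHChannel 𝒳 𝒴)

/-- The alphabet `{0, …, Bmax}` of the battery level. -/
abbrev Battery : Type := Fin (ch.Bmax + 1)

/-- The full battery. -/
def fullBattery : ch.Battery := Fin.last ch.Bmax

/-- The battery level `min (s - γ(x)) Bmax` after sending `x` out of the available energy `s`.
It is used only when `γ(x) ≤ s`. -/
def nextBattery (s : ℕ) (x : 𝒳) : ch.Battery :=
  ⟨min (s - ch.cost x) ch.Bmax, by omega⟩

/-- The inputs `x` satisfy the energy constraint for the initial battery level `b₁` and the harvested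
energies `e`; here `b` is the resulting sequence of battery levels. -/
def EnergyConstraint {N : ℕ} (b₁ : ch.Battery) (e : Fin N → ch.harvest) (x : Fin N → 𝒳) : Prop :=
  ∃ b : Fin (N + 1) → ch.Battery, b 0 = b₁ ∧ ∀ n : Fin N,
    ch.cost (x n) ≤ ch.S (b n.castSucc) (e n) ∧
    b n.succ = ch.nextBattery (ch.S (b n.castSucc) (e n)) (x n)

/-- The initial segment of `e` up to and including time `n`. -/
def upTo {N : ℕ} (e : Fin N → ch.harvest) (n : Fin N) : Fin (n.val + 1) → ch.harvest :=
  fun i => e ⟨i.val, by omega⟩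

/-- The input sequence that the causal functions `u` produce from `b₁` and `e`. -/
def causalOutput {N : ℕ} (u : (n : Fin N) → ch.Battery → (Fin (n.val + 1) → ch.harvest) → 𝒳)
    (b₁ : ch.Battery) (e : Fin N → ch.harvest) : Fin N → 𝒳 :=
  fun n => u n b₁ (ch.upTo e n)

/-- The input alphabet of block length `N` of the equivalent channel: the sequences of functions of
the initial battery level and, causally, of the harvested energies that always satisfy the energy
constraint. -/
def InputFun (N : ℕ) : Type _ :=
  {u : (n : Fin N) → ch.Battery → (Fin (n.val + 1) → ch.harvest) → 𝒳 //
    ∀ b₁ e, ch.EnergyConstraint b₁ e (ch.causalOutput u b₁ e)}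

instance (N : ℕ) : Finite (ch.InputFun N) := by
  unfold InputFun; infer_instance

noncomputable instance (N : ℕ) : Fintype (ch.InputFun N) := Fintype.ofFinite _

/-- The probability `p(y^N | u^N, b₁, e^N)` of the output sequence `y`. -/
noncomputable def outputProb {N : ℕ} (u : ch.InputFun N) (b₁ : ch.Battery)
    (e : Fin N → ch.harvest) (y : Fin N → 𝒴) : ℝ :=
  ∏ n, ch.W (ch.causalOutput u.1 b₁ e n) (y n)

/-! ### The harvesting process -/

/-- `E` is a homogeneous Markov process of order `r` with transition probabilities `K`: the
conditional probability that the next value is `e` given the whole past depends on the last `r`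
values `h` only and equals `K h e`. The law of the first `r` values is arbitrary. -/
def IsMarkovOfOrder {Ω : Type*} [MeasurableSpace Ω] (P : Measure Ω) (E : ℕ → Ω → ch.harvest)
    (r : ℕ) (K : (Fin r → ch.harvest) → ch.harvest → ℝ) : Prop :=
  (∀ h, K h ∈ stdSimplex ℝ ch.harvest) ∧
  ∀ (n : ℕ) (e : ℕ → ch.harvest),
    P.real {ω | ∀ i < n + r + 1, E i ω = e i} =
      P.real {ω | ∀ i < n + r, E i ω = e i} * K (fun i => e (n + i.val)) (e (n + r))

/-- The `r` harvested energies preceding time `n`, when `e` is preceded by the history `h`. -/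
def window {r N : ℕ} (h : Fin r → ch.harvest) (e : Fin N → ch.harvest) (n : Fin N) :
    Fin r → ch.harvest :=
  fun i => Fin.append h e ⟨n.val + i.val, by omega⟩

/-- The conditional probability `p(e^N | e^{-r})` of `e` given the history `h = e^{-r}`. -/
noncomputable def harvestProb {r N : ℕ} (K : (Fin r → ch.harvest) → ch.harvest → ℝ)
    (h : Fin r → ch.harvest) (e : Fin N → ch.harvest) : ℝ :=
  ∏ n, K (ch.window h e n) (e n)

/-! ### Operational capacity when the transmitter knows `B₁` and, causally, `E` -/

open Classical in
/-- The probability that message `m` is decoded wrongly, for the encoder `f` and the decoder `g`. -/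
noncomputable def errorProb {Ω : Type*} [MeasurableSpace Ω] (P : Measure Ω)
    (B₁ : Ω → ch.Battery) (E : ℕ → Ω → ch.harvest) {M N : ℕ}
    (f : Fin M → ch.InputFun N) (g : (Fin N → 𝒴) → Fin M) (m : Fin M) : ℝ :=
  ∑ b : ch.Battery, ∑ e : Fin N → ch.harvest,
    P.real {ω | B₁ ω = b ∧ ∀ i : Fin N, E i ω = e i} *
      ∑ y : Fin N → 𝒴 with g y ≠ m, ch.outputProb (f m) b e y

/-- The rate `R` (in nats per channel use) is achievable: there are codes of block length `N` with
`⌈exp (N R)⌉` messages whose maximal error probability tends to `0` as `N → ∞`. -/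
def Achievable {Ω : Type*} [MeasurableSpace Ω] (P : Measure Ω)
    (B₁ : Ω → ch.Battery) (E : ℕ → Ω → ch.harvest) (R : ℝ) : Prop :=
  ∀ ε > 0, ∀ᶠ N : ℕ in atTop,
    ∃ (f : Fin ⌈Real.exp (N * R)⌉₊ → ch.InputFun N) (g : (Fin N → 𝒴) → Fin ⌈Real.exp (N * R)⌉₊),
      ∀ m, ch.errorProb P B₁ E f g m < ε

/-- The channel capacity: the supremum of the achievable rates, as an extended real number. -/
noncomputable def capacity {Ω : Type*} [MeasurableSpace Ω] (P : Measure Ω)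
    (B₁ : Ω → ch.Battery) (E : ℕ → Ω → ch.harvest) : EReal :=
  sSup ((fun R : ℝ => (R : EReal)) '' {R | ch.Achievable P B₁ E R})

/-! ### The block bound `C̄_N` -/

/-- The joint law of `(U^N, E^N, Y^N)` given `B₁ = Bmax` and `E^{-r} = h`, for `U^N` with law `PU`. -/
noncomputable def blockLaw {r N : ℕ} (K : (Fin r → ch.harvest) → ch.harvest → ℝ)
    (PU : ch.InputFun N → ℝ) (h : Fin r → ch.harvest) :
    ch.InputFun N × (Fin N → ch.harvest) × (Fin N → 𝒴) → ℝ :=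
  fun t => PU t.1 * ch.harvestProb K h t.2.1 * ch.outputProb t.1 ch.fullBattery t.2.1 t.2.2

/-- The mutual information `I(U^N; Y^N | E^N, B₁ = Bmax, e^{-r} = h)`. -/
noncomputable def blockInfo {r N : ℕ} (K : (Fin r → ch.harvest) → ch.harvest → ℝ)
    (PU : ch.InputFun N → ℝ) (h : Fin r → ch.harvest) : ℝ :=
  condMutualInfo (ch.blockLaw K PU h) (fun t => t.1) (fun t => t.2.2) (fun t => t.2.1)

/-- The values over which `C̄_N` is the maximum. -/
def barSet {r : ℕ} (K : (Fin r → ch.harvest) → ch.harvest → ℝ) (N : ℕ) : Set ℝ :=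
  {c | ∃ PU ∈ stdSimplex ℝ (ch.InputFun N), ∃ h : Fin r → ch.harvest,
    c = 1 / (N : ℝ) * ch.blockInfo K PU h}

/-- The bound `C̄_N`. -/
noncomputable def barC {r : ℕ} (K : (Fin r → ch.harvest) → ch.harvest → ℝ) (N : ℕ) : ℝ :=
  sSup (ch.barSet K N)

/-! ### The relaxed bound `C̃_N` -/

/-- The finite alphabet of the available energy `S_n`. -/
def energyStates : Finset ℕ :=
  Finset.univ.image fun q : ch.Battery × ch.harvest => ch.S q.1 q.2

/-- The available energy as an element of its alphabet. -/
def energyState (b : ch.Battery) (e : ch.harvest) : ch.energyStates :=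
  ⟨ch.S b e, Finset.mem_image_of_mem (fun q : ch.Battery × ch.harvest => ch.S q.1 q.2)
    (Finset.mem_univ (b, e))⟩

/-- The alphabet of the overall state `Z_n = (E_{n-r+1}^n, S_n)`. -/
abbrev State (r : ℕ) : Type := (Fin r → ch.harvest) × ch.energyStates

/-- Drop the oldest of the last `r` harvested energies and append the new one
(for `r = 0` nothing is recorded). -/
def shiftWindow {r : ℕ} (h : Fin r → ch.harvest) (e : ch.harvest) : Fin r → ch.harvest :=
  Fin.tail (Fin.snoc (α := fun _ => ch.harvest) h e)

/-- The state following `z` when `x` is sent and then `e` is harvested. -/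
def nextState {r : ℕ} (z : ch.State r) (x : 𝒳) (e : ch.harvest) : ch.State r :=
  (ch.shiftWindow z.1 e, ch.energyState (ch.nextBattery z.2 x) e)

open Classical in
/-- The law `π_{b₁, h}` of `Z_1` given `B₁ = b₁` and `E^{-r} = h`. -/
noncomputable def initLaw {r : ℕ} (K : (Fin r → ch.harvest) → ch.harvest → ℝ)
    (b₁ : ch.Battery) (h : Fin r → ch.harvest) : ch.State r → ℝ :=
  fun z => ∑ e : ch.harvest, if z = (ch.shiftWindow h e, ch.energyState b₁ e) then K h e else 0

open Classical in
/-- The transition probability `p(y_n, e_{n+1}, z_{n+1} | x_n, z_n)`. -/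
noncomputable def stepProb {r : ℕ} (K : (Fin r → ch.harvest) → ch.harvest → ℝ)
    (x : 𝒳) (z : ch.State r) (y : 𝒴) (e : ch.harvest) (z' : ch.State r) : ℝ :=
  ch.W x y * K z.1 e * if z' = ch.nextState z x e then 1 else 0

/-- The set `𝒫*` of legal state-dependent input distributions: `p z` is a probability distribution
on `{x | γ(x) ≤ s(z)}` for every state `z`. -/
def legalInputs (r : ℕ) : Set (ch.State r → 𝒳 → ℝ) :=
  {p | ∀ z, p z ∈ stdSimplex ℝ 𝒳 ∧ ∀ x, (z.2 : ℕ) < ch.cost x → p z x = 0}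

/-- A realization of `(Z^{N+1}, X^N, Y^N, E_2^{N+1})`. -/
abbrev Path (r N : ℕ) : Type _ :=
  (Fin (N + 1) → ch.State r) × (Fin N → 𝒳) × (Fin N → 𝒴) × (Fin N → ch.harvest)

/-- The joint law of `(Z^{N+1}, X^N, Y^N, E_2^{N+1})` when `Z_1` has law `π` and `X_n` has the
conditional law `p n` given `Z_n`. -/
noncomputable def pathLaw {r N : ℕ} (K : (Fin r → ch.harvest) → ch.harvest → ℝ)
    (π : ch.State r → ℝ) (p : Fin N → ch.State r → 𝒳 → ℝ) : ch.Path r N → ℝ :=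
  fun t => π (t.1 0) * ∏ n : Fin N, (p n (t.1 n.castSucc) (t.2.1 n) *
    ch.stepProb K (t.2.1 n) (t.1 n.castSucc) (t.2.2.1 n) (t.2.2.2 n) (t.1 n.succ))

/-- The sum over `n` of `I(Y_n, E_{n+1}, Z_{n+1}; X_n | Z_n)`, for `Z_1` with law `π`. -/
noncomputable def sumInfo {r N : ℕ} (K : (Fin r → ch.harvest) → ch.harvest → ℝ)
    (π : ch.State r → ℝ) (p : Fin N → ch.State r → 𝒳 → ℝ) : ℝ :=
  ∑ n : Fin N, condMutualInfo (ch.pathLaw K π p)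
    (fun t => (t.2.2.1 n, t.2.2.2 n, t.1 n.succ)) (fun t => t.2.1 n) (fun t => t.1 n.castSucc)

/-- The values over which `c̃_N(π)` is the maximum. -/
def tildeSet {r : ℕ} (K : (Fin r → ch.harvest) → ch.harvest → ℝ) (N : ℕ) (π : ch.State r → ℝ) :
    Set ℝ :=
  {c | ∃ p : Fin N → ch.State r → 𝒳 → ℝ, (∀ n, p n ∈ ch.legalInputs r) ∧ c = ch.sumInfo K π p}

/-- The quantity `c̃_N(π)`. -/
noncomputable def tildec {r : ℕ} (K : (Fin r → ch.harvest) → ch.harvest → ℝ) (N : ℕ)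
    (π : ch.State r → ℝ) : ℝ :=
  sSup (ch.tildeSet K N π)

/-- The bound `C̃_N`; the supremum is over the finite set of histories `h = e^{-r}`. -/
noncomputable def tildeC {r : ℕ} (K : (Fin r → ch.harvest) → ch.harvest → ℝ) (N : ℕ) : ℝ :=
  1 / (N : ℝ) * ⨆ h : Fin r → ch.harvest, ch.tildec K N (ch.initLaw K ch.fullBattery h)

end EHChannel

/-! The capacity is bounded by `barC`, and `barC` by `tildeC`. Both bounds rest on one principle:
the information about the input carried by the output is at most the average relative entropy of the
conditional output laws to any reference law `Q`, so it suffices to choose `Q` well.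

Capacity ≤ `barC` (`Achievable.le_barC`). Take a code of length `r + kN` and let the reference law
depend on the initial battery level and on the energies. On the first `r` uses, where the energies
have an arbitrary law, `Q` is uniform and costs at most `r log |𝒴|`. On each later block `Q` is the
mixture of the output laws of the messages. Once the earlier energies are fixed, the rest of a
codeword is a causal function of the block energies, feasible for some battery level and hence, as
`S` is monotone, for a full battery. The cost of a block is therefore a block information started
from the last `r` energies, at most `N * barC` (`redundancyLE_block`). The channel is memoryless, so
product reference laws add their costs (`RedundancyLE.append`). Then `log_card_le_klSum` plays the
role of Fano's inequality, and `k → ∞` and `ε → 0` finish the argument.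

`barC` ≤ `tildeC` (`exists_policy`, `blockInfo_le_tildec`). Given an input law on causal functions,
let the policy `p n` be the conditional law of `X_n` given `Z_n`. The transition from `(Z_n, X_n)`
does not depend on the past, so the policy reproduces the law of every pair `(Z_n, X_n)`. Use as `Q`
the output law of this policy, given the energies. Keeping only the trajectories with the actual
next state bounds `Q` below by a product; the relative entropy then splits into one-step terms,
whose averages are the summands of `sumInfo`.

The maxima exist because conditional mutual information is a finite combination of terms `t log t`,
hence continuous in the joint law, and the input laws form compact sets. -/

/-! ### Relative entropy on finite types -/

/-- The relative entropy `∑ y, V y log (V y / Q y)`. -/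
noncomputable def klSum {Y : Type*} [Fintype Y] (V Q : Y → ℝ) : ℝ :=
  ∑ y, V y * Real.log (V y / Q y)

/-- The bound `log t ≤ t - 1` at `t = Q y / V y` gives `V y - Q y` as a pointwise lower bound. It is
enough that `Q` has total mass at most one, which the converse exploits. The support condition
cannot be dropped: with `V y / 0 = 0` an infinite term would be read as zero. -/
theorem klSum_nonneg {Y : Type*} [Fintype Y] {V Q : Y → ℝ} (hV : ∀ y, 0 ≤ V y)
    (hV1 : ∑ y, V y = 1) (hQ1 : ∑ y, Q y ≤ 1) (hQ : ∀ y, 0 ≤ Q y)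
    (hVQ : ∀ y, 0 < V y → 0 < Q y) : 0 ≤ klSum V Q := by
  have h : ∀ y, V y - Q y ≤ V y * Real.log (V y / Q y) := by
    intro y
    rcases (hV y).eq_or_lt with h0 | h0
    · simp [← h0, hQ y]
    · have hq := hVQ y h0
      have h1 := Real.log_le_sub_one_of_pos (div_pos hq h0)
      have h2 : Real.log (V y / Q y) = - Real.log (Q y / V y) := by
        rw [← Real.log_inv, inv_div]
      rw [h2]
      have h3 : V y * (Q y / V y) = Q y := by field_simp
      nlinarith
  have := Finset.sum_le_sum fun y (_ : y ∈ Finset.univ) => h y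
  rw [Finset.sum_sub_distrib] at this
  unfold klSum
  linarith

/-- The law of the output of the channel `V` with random input of law `w`. -/
def mixLaw {I Y : Type*} [Fintype I] (w : I → ℝ) (V : I → Y → ℝ) (y : Y) : ℝ :=
  ∑ i, w i * V i y

section
variable {I Y : Type*} [Fintype I] {w : I → ℝ} {V : I → Y → ℝ}

theorem mixLaw_nonneg (hw : ∀ i, 0 ≤ w i) (hV : ∀ i y, 0 ≤ V i y) (y : Y) : 0 ≤ mixLaw w V y :=
  Finset.sum_nonneg fun i _ => mul_nonneg (hw i) (hV i y)

theorem mixLaw_pos (hw : ∀ i, 0 ≤ w i) (hV : ∀ i y, 0 ≤ V i y) {i : I} {y : Y} (hi : 0 < w i)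
    (hy : 0 < V i y) : 0 < mixLaw w V y :=
  Finset.sum_pos' (fun i _ => mul_nonneg (hw i) (hV i y)) ⟨i, Finset.mem_univ i, mul_pos hi hy⟩

theorem sum_mixLaw [Fintype Y] (hw1 : ∑ i, w i = 1) (hV1 : ∀ i, ∑ y, V i y = 1) : ∑ y, mixLaw w V y = 1 := by
  unfold mixLaw
  rw [Finset.sum_comm]
  simp [← Finset.mul_sum, hV1, hw1]

/-- Among all output laws `Q`, the average relative entropy is smallest at the true output law. -/
theorem sum_klSum_mixLaw_le [Fintype Y] {Q : Y → ℝ} (hw : ∀ i, 0 ≤ w i) (hw1 : ∑ i, w i = 1)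
    (hV : ∀ i y, 0 ≤ V i y) (hV1 : ∀ i, ∑ y, V i y = 1) (hQ : ∀ y, 0 ≤ Q y)
    (hQ1 : ∑ y, Q y ≤ 1) (hVQ : ∀ i y, 0 < w i → 0 < V i y → 0 < Q y) :
    ∑ i, w i * klSum (V i) (mixLaw w V) ≤ ∑ i, w i * klSum (V i) Q := by
  have key : ∀ i y, w i * (V i y * Real.log (V i y / Q y)) =
      w i * (V i y * Real.log (V i y / mixLaw w V y)) +
        w i * V i y * Real.log (mixLaw w V y / Q y) := by
    intro i y
    rcases (hw i).eq_or_lt with h0 | h0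
    · simp [← h0]
    rcases (hV i y).eq_or_lt with h1 | h1
    · simp [← h1]
    have hq := hVQ i y h0 h1
    have hm := mixLaw_pos hw hV h0 h1
    rw [Real.log_div h1.ne' hq.ne', Real.log_div h1.ne' hm.ne', Real.log_div hm.ne' hq.ne']
    ring
  have h2 : 0 ≤ klSum (mixLaw w V) Q := by
    refine klSum_nonneg (mixLaw_nonneg hw hV) (sum_mixLaw hw1 hV1) hQ1 hQ fun y hy => ?_
    obtain ⟨i, -, hi⟩ := Finset.exists_lt_of_sum_lt
      (show ∑ i : I, (0 : ℝ) < ∑ i, w i * V i y by simpa [mixLaw] using hy)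
    exact hVQ i y (lt_of_le_of_ne (hw i) fun h => by simp [← h] at hi)
      (lt_of_le_of_ne (hV i y) fun h => by simp [← h] at hi)
  -- The compensation identity: the excess over the mixture is exactly the relative entropy of the
  -- mixture to `Q`.
  have h3 : ∑ i, w i * klSum (V i) Q =
      ∑ i, w i * klSum (V i) (mixLaw w V) + klSum (mixLaw w V) Q := by
    have h4 : klSum (mixLaw w V) Q =
        ∑ i, ∑ y, w i * V i y * Real.log (mixLaw w V y / Q y) := by
      rw [Finset.sum_comm]
      simp only [klSum, ← Finset.sum_mul]
      rfl
    rw [h4, ← Finset.sum_add_distrib]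
    refine Finset.sum_congr rfl fun i _ => ?_
    simp only [klSum, Finset.mul_sum, ← Finset.sum_add_distrib]
    exact Finset.sum_congr rfl fun y _ => key i y
  linarith

/-- The relative entropy of product laws, one of which is a conditional law. -/
theorem klSum_prod {Y₁ Y₂ : Type*} [Fintype Y₁] [Fintype Y₂] {V₁ Q₁ : Y₁ → ℝ} {V₂ Q₂ : Y₂ → ℝ}
    (h₁ : ∀ y, 0 ≤ V₁ y) (h₂ : ∀ y, 0 ≤ V₂ y) (s₁ : ∑ y, V₁ y = 1) (s₂ : ∑ y, V₂ y = 1)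
    (q₁ : ∀ y, 0 < V₁ y → 0 < Q₁ y) (q₂ : ∀ y, 0 < V₂ y → 0 < Q₂ y) :
    klSum (fun y : Y₁ × Y₂ => V₁ y.1 * V₂ y.2) (fun y => Q₁ y.1 * Q₂ y.2) =
      klSum V₁ Q₁ + klSum V₂ Q₂ := by
  have key : ∀ a b, V₁ a * V₂ b * Real.log (V₁ a * V₂ b / (Q₁ a * Q₂ b)) =
      V₁ a * Real.log (V₁ a / Q₁ a) * V₂ b + V₁ a * (V₂ b * Real.log (V₂ b / Q₂ b)) := by
    intro a b
    rcases (h₁ a).eq_or_lt with h | h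
    · simp [← h]
    rcases (h₂ b).eq_or_lt with h' | h'
    · simp [← h']
    rw [mul_div_mul_comm, Real.log_mul (div_pos h (q₁ a h)).ne' (div_pos h' (q₂ b h')).ne']
    ring
  simp only [klSum, Fintype.sum_prod_type, key, Finset.sum_add_distrib, ← Finset.mul_sum,
    ← Finset.sum_mul, s₁, s₂]
  ring

/-- The expectation of `G ∘ φ` is the expectation of `G` under the law of `φ`. -/
theorem sum_mul_comp_eq {U : Type*} [Fintype U] [DecidableEq U] (φ : I → U) (G : U → ℝ) :
    ∑ u, (∑ i with φ i = u, w i) * G u = ∑ i, w i * G (φ i) := by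
  rw [← Finset.sum_fiberwise Finset.univ φ]
  refine Finset.sum_congr rfl fun u _ => ?_
  rw [Finset.sum_mul]
  refine Finset.sum_congr rfl fun i hi => ?_
  rw [(Finset.mem_filter.1 hi).2]

end

/-! ### A converse for codes in terms of relative entropy. -/

open Classical in
/-- The converse inequality for a code with `M` codewords `V m` and decoder `g`. -/
theorem log_card_le_klSum {Y : Type*} [Fintype Y] {M : ℕ} (hM : 0 < M) {V : Fin M → Y → ℝ}
    (g : Y → Fin M) {Q : Y → ℝ} (hV : ∀ m y, 0 ≤ V m y) (hV1 : ∀ m, ∑ y, V m y = 1)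
    (hQ : ∀ y, 0 ≤ Q y) (hQ1 : ∑ y, Q y ≤ 1) (hVQ : ∀ m y, 0 < V m y → 0 < Q y) :
    (1 - ∑ m, 1 / (M : ℝ) * ∑ y with g y ≠ m, V m y) * Real.log M - Real.log 2 ≤
      ∑ m, 1 / (M : ℝ) * klSum (V m) Q := by
  have hM' : (0 : ℝ) < M := by exact_mod_cast hM
  let a : Fin M × Y → ℝ := fun t => 1 / (M : ℝ) * V t.1 t.2
  -- The reference law is tilted towards correct decoding: its mass is `Q y / 2` at `m = g y` and `Q
  -- y / (2 M)` elsewhere, so its total is at most one. The ratio `a / b` then gains the factor `1 /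
  -- M` exactly on the event of correct decoding, and the normalization `1 / 2` causes the loss `log
  -- 2`.
  let b : Fin M × Y → ℝ := fun t => 1 / (M : ℝ) * Q t.2 * (if g t.2 = t.1 then (M : ℝ) else 1) / 2
  have hs : ∀ m, ∑ y with g y ≠ m, V m y = 1 - ∑ y, V m y * (if g y = m then 1 else 0) := by
    intro m
    rw [Finset.sum_filter, eq_sub_iff_add_eq, ← Finset.sum_add_distrib]
    refine (Finset.sum_congr rfl fun y _ => ?_).trans (hV1 m)
    by_cases h : g y = m <;> simp [h]
  have ha1 : ∑ t, a t = 1 := by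
    simp [a, Fintype.sum_prod_type, ← Finset.mul_sum, hV1, hM'.ne']
  have hb1 : ∑ t, b t ≤ 1 := by
    rw [Fintype.sum_prod_type_right]
    calc ∑ y, ∑ m, b (m, y) ≤ ∑ y, Q y := by
          refine Finset.sum_le_sum fun y _ => ?_
          have : ∑ m : Fin M, (if g y = m then (M : ℝ) else 1) ≤ M + M := by
            calc ∑ m : Fin M, (if g y = m then (M : ℝ) else 1)
                ≤ ∑ m : Fin M, ((if g y = m then (M : ℝ) else 0) + 1) := by
                  refine Finset.sum_le_sum fun m _ => ?_
                  split_ifs <;> simp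
              _ = M + M := by simp [Finset.sum_add_distrib]
          simp only [b, ← Finset.sum_div, ← Finset.mul_sum]
          rw [div_le_iff₀ two_pos, one_div, mul_comm _ (Q y), mul_assoc]
          refine mul_le_mul_of_nonneg_left ?_ (hQ y)
          rw [inv_mul_le_iff₀ hM']
          linarith
      _ ≤ 1 := hQ1
  have h := klSum_nonneg (V := a) (Q := b) (fun t => mul_nonneg (by positivity) (hV _ _)) ha1 hb1
    (fun t => div_nonneg (mul_nonneg (mul_nonneg (by positivity) (hQ _))
      (by split_ifs <;> positivity)) two_pos.le) (fun t ht => ?_)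
  · have key : ∀ m y, a (m, y) * Real.log (a (m, y) / b (m, y)) =
        1 / (M : ℝ) * (V m y * Real.log (V m y / Q y)) + 1 / (M : ℝ) * V m y * Real.log 2 -
          1 / (M : ℝ) * (V m y * (if g y = m then 1 else 0)) * Real.log M := by
      intro m y
      rcases (hV m y).eq_or_lt with h | h
      · simp [a, ← h]
      have hq := hVQ m y h
      have h1 : a (m, y) / b (m, y) = V m y / Q y * 2 / (if g y = m then (M : ℝ) else 1) := by
        simp only [a, b]
        split_ifs <;> field_simp
      have h2 : Real.log (if g y = m then (M : ℝ) else 1) =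
          (if g y = m then 1 else 0) * Real.log M := by
        split_ifs <;> simp
      rw [h1, Real.log_div (by positivity) (by split_ifs <;> positivity),
        Real.log_mul (by positivity) two_ne_zero, h2]
      simp only [a]
      ring
    rw [klSum, Fintype.sum_prod_type] at h
    simp only [key, Finset.sum_add_distrib, Finset.sum_sub_distrib, ← Finset.mul_sum,
      ← Finset.sum_mul, hV1] at h
    simp only [hs, klSum, ← Finset.mul_sum, Finset.sum_sub_distrib] at h ⊢
    simp only [Finset.sum_const, Finset.card_univ, Fintype.card_fin, nsmul_eq_mul, mul_one] at h ⊢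
    have hc : 1 / (M : ℝ) * M = 1 := by field_simp
    rw [← mul_assoc, hc] at h
    rw [mul_sub, hc]
    linarith
  · have h1 : 0 < V t.1 t.2 := pos_of_mul_pos_right ht (by positivity)
    have := hVQ _ _ h1
    simp only [b]
    split_ifs <;> positivity

/-! ### Conditional mutual information -/

section
variable {T α β δ : Type*} [Fintype T]

theorem finProb_pos {μ : T → ℝ} (hμ : ∀ t, 0 ≤ μ t) {A : T → Prop} {t : T} (ht : 0 < μ t)
    (hA : A t) : 0 < finProb μ A := by
  classical
  exact Finset.sum_pos' (fun t _ => hμ t) ⟨t, by simp [hA], ht⟩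

theorem finProb_eq_sum_ite (μ : T → ℝ) (A : T → Prop) [DecidablePred A] :
    finProb μ A = ∑ t, if A t then μ t else 0 := by
  rw [finProb, Finset.sum_filter]
  congr!

-- Grouping the sample points by the value of `A` produces terms `t log t` in the probabilities,
-- which are continuous even at `t = 0`; the individual terms on the left are not visibly so.
open Classical in
theorem sum_mul_log_finProb (μ : T → ℝ) (A : T → α) :
    ∑ t, μ t * Real.log (finProb μ fun t' => A t' = A t) =
      ∑ a ∈ Finset.univ.image A,
        finProb μ (fun t => A t = a) * Real.log (finProb μ fun t => A t = a) := by
  rw [← Finset.sum_fiberwise_of_maps_to (s := Finset.univ) (t := Finset.univ.image A) (g := A)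
    (fun t ht => Finset.mem_image_of_mem A ht)]
  refine Finset.sum_congr rfl fun a _ => ?_
  conv_rhs => enter [1]; rw [finProb]
  rw [Finset.sum_mul]
  refine Finset.sum_congr rfl fun t ht => ?_
  rw [(Finset.mem_filter.1 ht).2]

/-- The logarithm splits at each point of positive mass, where all four probabilities are positive,
and the other points contribute nothing. This is the formula with four entropies. -/
theorem condMutualInfo_eq_sum {μ : T → ℝ} (hμ : ∀ t, 0 ≤ μ t) (A : T → α) (B : T → β)
    (C : T → δ) :
    condMutualInfo μ A B C =
      (∑ t, μ t * Real.log (finProb μ fun t' => (A t', B t', C t') = (A t, B t, C t)) +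
        ∑ t, μ t * Real.log (finProb μ fun t' => C t' = C t)) -
      (∑ t, μ t * Real.log (finProb μ fun t' => (A t', C t') = (A t, C t)) +
        ∑ t, μ t * Real.log (finProb μ fun t' => (B t', C t') = (B t, C t))) := by
  simp only [condMutualInfo, ← Finset.sum_add_distrib, ← Finset.sum_sub_distrib, Prod.mk.injEq]
  refine Finset.sum_congr rfl fun t _ => ?_
  rcases (hμ t).eq_or_lt with h | h
  · simp [← h]
  have h1 := finProb_pos hμ h (A := fun t' => A t' = A t ∧ B t' = B t ∧ C t' = C t) ⟨rfl, rfl, rfl⟩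
  have h2 := finProb_pos hμ h (A := fun t' => C t' = C t) rfl
  have h3 := finProb_pos hμ h (A := fun t' => A t' = A t ∧ C t' = C t) ⟨rfl, rfl⟩
  have h4 := finProb_pos hμ h (A := fun t' => B t' = B t ∧ C t' = C t) ⟨rfl, rfl⟩
  rw [Real.log_div (mul_pos h1 h2).ne' (mul_pos h3 h4).ne', Real.log_mul h1.ne' h2.ne',
    Real.log_mul h3.ne' h4.ne']
  ring

theorem continuous_sum_mul_log_finProb (A : T → α) :
    Continuous fun μ : T → ℝ => ∑ t, μ t * Real.log (finProb μ fun t' => A t' = A t) := by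
  classical
  simp only [sum_mul_log_finProb]
  refine continuous_finsetSum _ fun a _ => Real.continuous_mul_log.comp ?_
  exact continuous_finsetSum _ fun t _ => continuous_apply t

theorem continuousOn_condMutualInfo (A : T → α) (B : T → β) (C : T → δ) :
    ContinuousOn (fun μ : T → ℝ => condMutualInfo μ A B C) {μ | ∀ t, 0 ≤ μ t} := by
  refine ContinuousOn.congr (Continuous.continuousOn ?_) fun μ hμ => condMutualInfo_eq_sum hμ A B C
  exact ((continuous_sum_mul_log_finProb _).add (continuous_sum_mul_log_finProb _)).sub
    ((continuous_sum_mul_log_finProb _).add (continuous_sum_mul_log_finProb _))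

/-- The conditional mutual information depends on the joint law of the random variables only. -/
theorem condMutualInfo_comp {T' : Type*} [Fintype T'] (μ : T → ℝ) (φ : T → T') (A : T' → α)
    (B : T' → β) (C : T' → δ) :
    condMutualInfo μ (fun t => A (φ t)) (fun t => B (φ t)) (fun t => C (φ t)) =
      condMutualInfo (fun t' => finProb μ fun t => φ t = t') A B C := by
  classical
  have h : ∀ D : T' → Prop, finProb (fun t' => finProb μ fun t => φ t = t') D =
      finProb μ fun t => D (φ t) := by
    intro D
    have := sum_mul_comp_eq (w := μ) φ fun u => if D u then 1 else 0
    simp only [mul_ite, mul_one, mul_zero] at this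
    rw [finProb_eq_sum_ite, finProb_eq_sum_ite]
    simp only [← this, finProb]
  have h2 := sum_mul_comp_eq (w := μ) φ fun u => Real.log
    (finProb μ (fun t' => A (φ t') = A u ∧ B (φ t') = B u ∧ C (φ t') = C u) *
      finProb μ (fun t' => C (φ t') = C u) /
      (finProb μ (fun t' => A (φ t') = A u ∧ C (φ t') = C u) *
        finProb μ (fun t' => B (φ t') = B u ∧ C (φ t') = C u)))
  simp only [condMutualInfo, h]
  rw [← h2]
  simp only [finProb]

end

namespace EHChannel

variable {𝒳 𝒴 : Type*} [Zero 𝒳] [Fintype 𝒴] (ch : EHChannel 𝒳 𝒴)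

/-! ### Basic facts about the laws -/

theorem W_nonneg (x : 𝒳) (y : 𝒴) : 0 ≤ ch.W x y := (ch.W_mem x).1 y

theorem sum_W (x : 𝒳) : ∑ y, ch.W x y = 1 := (ch.W_mem x).2

/-- The probability of the output word `y` for the input word `x`. -/
noncomputable def wordProb {N : ℕ} (x : Fin N → 𝒳) (y : Fin N → 𝒴) : ℝ := ∏ n, ch.W (x n) (y n)

theorem wordProb_nonneg {N : ℕ} (x : Fin N → 𝒳) (y : Fin N → 𝒴) : 0 ≤ ch.wordProb x y :=
  Finset.prod_nonneg fun _ _ => ch.W_nonneg _ _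

theorem sum_wordProb {N : ℕ} (x : Fin N → 𝒳) : ∑ y, ch.wordProb x y = 1 := by
  have := Finset.prod_univ_sum (fun _ : Fin N => (Finset.univ : Finset 𝒴))
    (fun n y => ch.W (x n) y)
  rw [Fintype.piFinset_univ] at this
  simp only [wordProb]
  rw [← this]
  simp [sum_W]

theorem wordProb_le_one {N : ℕ} (x : Fin N → 𝒳) (y : Fin N → 𝒴) : ch.wordProb x y ≤ 1 :=
  ch.sum_wordProb x ▸ Finset.single_le_sum (fun y _ => ch.wordProb_nonneg x y) (Finset.mem_univ y)

theorem wordProb_cons {N : ℕ} (x : Fin (N + 1) → 𝒳) (y₀ : 𝒴) (y : Fin N → 𝒴) :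
    ch.wordProb x (Fin.cons y₀ y) = ch.W (x 0) y₀ * ch.wordProb (Fin.tail x) y := by
  simp [wordProb, Fin.prod_univ_succ, Fin.tail]

theorem wordProb_append {m n : ℕ} (x : Fin (m + n) → 𝒳) (y₁ : Fin m → 𝒴) (y₂ : Fin n → 𝒴) :
    ch.wordProb x (Fin.append y₁ y₂) =
      ch.wordProb (fun i => x (Fin.castAdd n i)) y₁ *
        ch.wordProb (fun i => x (Fin.natAdd m i)) y₂ := by
  simp [wordProb, Fin.prod_univ_add]

/-- A transition probability from histories of length `r` to harvested energies. -/
def IsHarvestKernel {r : ℕ} (K : (Fin r → ch.harvest) → ch.harvest → ℝ) : Prop :=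
  ∀ h, K h ∈ stdSimplex ℝ ch.harvest

/-! ### Sliding windows over the harvested energies. -/

theorem append_apply {m n : ℕ} (h : Fin m → ch.harvest) (e : Fin n → ch.harvest) (k : ℕ)
    (hk : k < m + n) :
    Fin.append h e ⟨k, hk⟩ = if hm : k < m then h ⟨k, hm⟩ else e ⟨k - m, by omega⟩ := by
  split_ifs with hm
  · exact Fin.append_left h e ⟨k, hm⟩
  · have : (⟨k, hk⟩ : Fin (m + n)) = Fin.natAdd m ⟨k - m, by omega⟩ := by
      ext; simp; omega
    rw [this, Fin.append_right]

theorem shiftWindow_apply {r : ℕ} (h : Fin r → ch.harvest) (e : ch.harvest) (i : Fin r) :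
    ch.shiftWindow h e i = if hi : i.val + 1 < r then h ⟨i + 1, hi⟩ else e := by
  simp only [shiftWindow, Fin.tail, Fin.snoc, Fin.val_succ]
  split_ifs <;> rfl

theorem window_zero {r N : ℕ} (h : Fin r → ch.harvest) (e : Fin (N + 1) → ch.harvest) :
    ch.window h e 0 = h := by
  funext i
  simp [window, append_apply]

theorem window_cons_succ {r N : ℕ} (h : Fin r → ch.harvest) (e₀ : ch.harvest)
    (e : Fin N → ch.harvest) (n : Fin N) :
    ch.window h (Fin.cons e₀ e : Fin (N + 1) → ch.harvest) n.succ =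
      ch.window (ch.shiftWindow h e₀) e n := by
  funext i
  simp only [window, append_apply, shiftWindow_apply, Fin.val_succ]
  have hi := i.2
  by_cases h1 : n.val + i.val < r
  · rw [dif_pos h1]
    by_cases h2 : n.val + i.val + 1 < r
    · rw [dif_pos h2, dif_pos (by omega)]
      congr 2; omega
    · rw [dif_neg h2, dif_neg (by omega)]
      have : (⟨n.val + 1 + i.val - r, by omega⟩ : Fin (N + 1)) = 0 := by ext; simp; omega
      rw [this, Fin.cons_zero]
  · rw [dif_neg h1, dif_neg (by omega)]
    have : (⟨n.val + 1 + i.val - r, by omega⟩ : Fin (N + 1)) =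
      Fin.succ ⟨n.val + i.val - r, by omega⟩ := by ext; simp; omega
    rw [this, Fin.cons_succ]

/-- The last `r` harvested energies of `h` followed by `e`. -/
def lastWindow {r m : ℕ} (h : Fin r → ch.harvest) (e : Fin m → ch.harvest) :
    Fin r → ch.harvest :=
  fun i => Fin.append h e ⟨m + i.val, by omega⟩

theorem window_append_castAdd {r m n : ℕ} (h : Fin r → ch.harvest) (e₁ : Fin m → ch.harvest)
    (e₂ : Fin n → ch.harvest) (j : Fin m) :
    ch.window h (Fin.append e₁ e₂) (Fin.castAdd n j) = ch.window h e₁ j := by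
  funext i
  simp only [window, append_apply, Fin.val_castAdd]
  split_ifs
  · rfl
  · rfl
  · omega

theorem window_append_natAdd {r m n : ℕ} (h : Fin r → ch.harvest) (e₁ : Fin m → ch.harvest)
    (e₂ : Fin n → ch.harvest) (j : Fin n) :
    ch.window h (Fin.append e₁ e₂) (Fin.natAdd m j) = ch.window (ch.lastWindow h e₁) e₂ j := by
  funext i
  simp only [window, append_apply, lastWindow, Fin.val_natAdd]
  have hi := i.2
  split_ifs <;> first | omega | (congr 2; omega)

section
variable {ch} {r : ℕ} {K : (Fin r → ch.harvest) → ch.harvest → ℝ}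

theorem harvestProb_nonneg (hK : ch.IsHarvestKernel K) {N : ℕ} (h : Fin r → ch.harvest)
    (e : Fin N → ch.harvest) : 0 ≤ ch.harvestProb K h e :=
  Finset.prod_nonneg fun _ _ => (hK _).1 _

theorem harvestProb_cons {N : ℕ} (h : Fin r → ch.harvest) (e₀ : ch.harvest)
    (e : Fin N → ch.harvest) :
    ch.harvestProb K h (Fin.cons e₀ e : Fin (N + 1) → ch.harvest) =
      K h e₀ * ch.harvestProb K (ch.shiftWindow h e₀) e := by
  simp [harvestProb, Fin.prod_univ_succ, window_zero, window_cons_succ]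

/-- The Markov property: after `e₁` the process restarts from its last `r` values, so each block of
a long code has a law of the same form. -/
theorem harvestProb_append {m n : ℕ} (h : Fin r → ch.harvest) (e₁ : Fin m → ch.harvest)
    (e₂ : Fin n → ch.harvest) :
    ch.harvestProb K h (Fin.append e₁ e₂) =
      ch.harvestProb K h e₁ * ch.harvestProb K (ch.lastWindow h e₁) e₂ := by
  simp [harvestProb, Fin.prod_univ_add, window_append_castAdd, window_append_natAdd]

theorem sum_fin_succ {α : Type*} [Fintype α] {N : ℕ} (f : (Fin (N + 1) → α) → ℝ) :
    ∑ e, f e = ∑ a : α, ∑ e : Fin N → α, f (Fin.cons a e) := by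
  rw [← (Fin.consEquiv fun _ => α).sum_comp, Fintype.sum_prod_type]
  rfl

theorem sum_fin_add {α : Type*} [Fintype α] {m n : ℕ} (f : (Fin (m + n) → α) → ℝ) :
    ∑ e, f e = ∑ e₁ : Fin m → α, ∑ e₂ : Fin n → α, f (Fin.append e₁ e₂) := by
  rw [← (Fin.appendEquiv m n).sum_comp, Fintype.sum_prod_type]
  rfl

theorem sum_harvestProb (hK : ch.IsHarvestKernel K) {N : ℕ} (h : Fin r → ch.harvest) :
    ∑ e : Fin N → ch.harvest, ch.harvestProb K h e = 1 := by
  induction N generalizing h with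
  | zero => simp [harvestProb]
  | succ N ih =>
    rw [sum_fin_succ]
    simp only [harvestProb_cons, ← Finset.mul_sum, ih, mul_one]
    exact (hK h).2

end

/-! ### Causal functions and the energy constraint -/

/-- A sequence of causal functions of the harvested energies. -/
abbrev CausalFun (N : ℕ) : Type _ := (n : Fin N) → (Fin (n.val + 1) → ch.harvest) → 𝒳

/-- The inputs that the causal functions `u` produce from `e`. -/
def run {N : ℕ} (u : ch.CausalFun N) (e : Fin N → ch.harvest) : Fin N → 𝒳 :=
  fun n => u n (ch.upTo e n)

variable {ch}

theorem energyConstraint_succ {N : ℕ} {b : ch.Battery} {e : Fin (N + 1) → ch.harvest}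
    {x : Fin (N + 1) → 𝒳} :
    ch.EnergyConstraint b e x ↔ ch.cost (x 0) ≤ ch.S b (e 0) ∧
      ch.EnergyConstraint (ch.nextBattery (ch.S b (e 0)) (x 0)) (Fin.tail e) (Fin.tail x) := by
  constructor
  · rintro ⟨bs, h0, h⟩
    have h1 := h 0
    rw [Fin.castSucc_zero, h0] at h1
    exact ⟨h1.1, fun i => bs i.succ, h1.2, fun n => h n.succ⟩
  · rintro ⟨h1, bs, h0, h⟩
    refine ⟨Fin.cons b bs, rfl, fun n => ?_⟩
    refine Fin.cases ?_ (fun n => ?_) n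
    · exact ⟨h1, h0⟩
    · exact h n

theorem energyConstraint_zero_left {b : ch.Battery} {e : Fin 0 → ch.harvest} {x : Fin 0 → 𝒳} :
    ch.EnergyConstraint b e x :=
  ⟨fun _ => b, rfl, fun n => n.elim0⟩

theorem nextBattery_mono {s s' : ℕ} (h : s ≤ s') (x : 𝒳) :
    ch.nextBattery s x ≤ ch.nextBattery s' x := by
  simp only [nextBattery, Fin.mk_le_mk]
  omega

/-- By induction the battery levels stay ordered when the same inputs are sent from a higher level.
The monotonicity of `S` enters the whole proof through this lemma. -/
theorem EnergyConstraint.mono (hS : ∀ e : ch.harvest, Monotone fun b : ch.Battery => ch.S b e)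
    {N : ℕ} {b b' : ch.Battery} (hb : b ≤ b') {e : Fin N → ch.harvest} {x : Fin N → 𝒳}
    (h : ch.EnergyConstraint b e x) : ch.EnergyConstraint b' e x := by
  induction N generalizing b b' with
  | zero => exact energyConstraint_zero_left
  | succ N ih =>
    rw [energyConstraint_succ] at h ⊢
    have hs : ch.S b (e 0) ≤ ch.S b' (e 0) := hS (e 0) hb
    exact ⟨h.1.trans hs, ih (nextBattery_mono hs _) h.2⟩

theorem EnergyConstraint.full (hS : ∀ e : ch.harvest, Monotone fun b : ch.Battery => ch.S b e)
    {N : ℕ} {b : ch.Battery} {e : Fin N → ch.harvest} {x : Fin N → 𝒳}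
    (h : ch.EnergyConstraint b e x) : ch.EnergyConstraint ch.fullBattery e x :=
  h.mono hS (Fin.le_last b)

theorem energyConstraint_zero_input {N : ℕ} (b : ch.Battery) (e : Fin N → ch.harvest) :
    ch.EnergyConstraint b e fun _ => (0 : 𝒳) := by
  induction N generalizing b with
  | zero => exact energyConstraint_zero_left
  | succ N ih =>
    rw [energyConstraint_succ]
    exact ⟨by simp [ch.cost_zero], ih _ _⟩

theorem EnergyConstraint.castAdd {m n : ℕ} {b : ch.Battery} {e : Fin (m + n) → ch.harvest}
    {x : Fin (m + n) → 𝒳} (h : ch.EnergyConstraint b e x) :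
    ch.EnergyConstraint b (fun i => e (Fin.castAdd n i)) (fun i => x (Fin.castAdd n i)) := by
  obtain ⟨bs, h0, h⟩ := h
  exact ⟨fun i => bs ⟨i.val, by omega⟩, h0, fun i => h (Fin.castAdd n i)⟩

theorem EnergyConstraint.natAdd {m n : ℕ} {b : ch.Battery} {e : Fin (m + n) → ch.harvest}
    {x : Fin (m + n) → 𝒳} (h : ch.EnergyConstraint b e x) :
    ∃ b', ch.EnergyConstraint b' (fun i => e (Fin.natAdd m i)) (fun i => x (Fin.natAdd m i)) := by
  obtain ⟨bs, h0, h⟩ := h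
  exact ⟨_, fun i => bs (Fin.natAdd m i), rfl, fun i => h (Fin.natAdd m i)⟩

instance (N : ℕ) : Nonempty (ch.InputFun N) :=
  ⟨⟨fun _ _ _ => 0, fun b e => energyConstraint_zero_input b e⟩⟩

open Classical in
/-- Causal functions that are legal for a full initial battery, made into an element of `InputFun`
that sends zeros for all other initial battery levels. -/
noncomputable def CausalFun.toInputFun {N : ℕ} (u : ch.CausalFun N)
    (hu : ∀ e, ch.EnergyConstraint ch.fullBattery e (ch.run u e)) : ch.InputFun N :=
  ⟨fun n b e => if b = ch.fullBattery then u n e else 0, fun b e => by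
    unfold causalOutput
    by_cases hb : b = ch.fullBattery
    · simp only [hb, if_true]
      exact hu e
    · simpa only [hb, if_false] using energyConstraint_zero_input b e⟩

theorem CausalFun.outputProb_toInputFun {N : ℕ} (u : ch.CausalFun N)
    (hu : ∀ e, ch.EnergyConstraint ch.fullBattery e (ch.run u e)) (e : Fin N → ch.harvest)
    (y : Fin N → 𝒴) :
    ch.outputProb (CausalFun.toInputFun u hu) ch.fullBattery e y = ch.wordProb (ch.run u e) y := by
  simp [outputProb, wordProb, CausalFun.toInputFun, causalOutput, run]

end EHChannel

namespace EHChannel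

variable {𝒳 𝒴 : Type*} [Zero 𝒳] [Fintype 𝒴] {ch : EHChannel 𝒳 𝒴}

/-! ### The block information -/

section
variable {r : ℕ} {K : (Fin r → ch.harvest) → ch.harvest → ℝ}

theorem outputProb_nonneg {N : ℕ} (u : ch.InputFun N) (b : ch.Battery) (e : Fin N → ch.harvest)
    (y : Fin N → 𝒴) : 0 ≤ ch.outputProb u b e y :=
  ch.wordProb_nonneg _ y

theorem sum_outputProb {N : ℕ} (u : ch.InputFun N) (b : ch.Battery) (e : Fin N → ch.harvest) :
    ∑ y, ch.outputProb u b e y = 1 :=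
  ch.sum_wordProb _

theorem stepProb_nonneg (hK : ch.IsHarvestKernel K) (x : 𝒳) (z : ch.State r) (y : 𝒴)
    (e : ch.harvest) (z' : ch.State r) : 0 ≤ ch.stepProb K x z y e z' :=
  mul_nonneg (mul_nonneg (ch.W_nonneg x y) ((hK _).1 e)) (by split_ifs <;> simp)

theorem blockLaw_nonneg (hK : ch.IsHarvestKernel K) {N : ℕ} {PU : ch.InputFun N → ℝ}
    (hPU : ∀ u, 0 ≤ PU u) (h : Fin r → ch.harvest)
    (t : ch.InputFun N × (Fin N → ch.harvest) × (Fin N → 𝒴)) : 0 ≤ ch.blockLaw K PU h t :=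
  mul_nonneg (mul_nonneg (hPU _) (harvestProb_nonneg hK _ _)) (outputProb_nonneg _ _ _ _)

variable [Fintype 𝒳]

/-- The block information is the average over `e` of the mutual information between `u` and `y`. -/
theorem blockInfo_eq (hK : ch.IsHarvestKernel K) {N : ℕ} {PU : ch.InputFun N → ℝ}
    (hPU : PU ∈ stdSimplex ℝ (ch.InputFun N)) (h : Fin r → ch.harvest) :
    ch.blockInfo K PU h = ∑ e, ch.harvestProb K h e * ∑ u, PU u *
      klSum (ch.outputProb u ch.fullBattery e)
        (mixLaw PU fun u => ch.outputProb u ch.fullBattery e) := by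
  classical
  have key : ∀ (u : ch.InputFun N) (e : Fin N → ch.harvest) (y : Fin N → 𝒴),
      ch.blockLaw K PU h (u, e, y) * Real.log
        (finProb (ch.blockLaw K PU h) (fun t => t.1 = u ∧ t.2.2 = y ∧ t.2.1 = e) *
            finProb (ch.blockLaw K PU h) (fun t => t.2.1 = e) /
          (finProb (ch.blockLaw K PU h) (fun t => t.1 = u ∧ t.2.1 = e) *
            finProb (ch.blockLaw K PU h) (fun t => t.2.2 = y ∧ t.2.1 = e))) =
      ch.harvestProb K h e * (PU u * (ch.outputProb u ch.fullBattery e y *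
        Real.log (ch.outputProb u ch.fullBattery e y /
          mixLaw PU (fun u => ch.outputProb u ch.fullBattery e) y))) := by
    intro u e y
    have h1 : finProb (ch.blockLaw K PU h) (fun t => t.1 = u ∧ t.2.2 = y ∧ t.2.1 = e) =
        PU u * ch.harvestProb K h e * ch.outputProb u ch.fullBattery e y := by
      simp [finProb_eq_sum_ite, Fintype.sum_prod_type, ite_and, blockLaw]
    have h2 : finProb (ch.blockLaw K PU h) (fun t => t.2.1 = e) = ch.harvestProb K h e := by
      simp [finProb_eq_sum_ite, Fintype.sum_prod_type, blockLaw, ← Finset.mul_sum,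
        sum_outputProb, ← Finset.sum_mul, hPU.2, Finset.sum_ite_irrel]
    have h3 : finProb (ch.blockLaw K PU h) (fun t => t.1 = u ∧ t.2.1 = e) =
        PU u * ch.harvestProb K h e := by
      simp [finProb_eq_sum_ite, Fintype.sum_prod_type, blockLaw, ← Finset.mul_sum,
        sum_outputProb, ite_and, Finset.sum_ite_irrel]
    have h4 : finProb (ch.blockLaw K PU h) (fun t => t.2.2 = y ∧ t.2.1 = e) =
        ch.harvestProb K h e * mixLaw PU (fun u => ch.outputProb u ch.fullBattery e) y := by
      simp [finProb_eq_sum_ite, Fintype.sum_prod_type, blockLaw, ite_and, mixLaw, Finset.mul_sum]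
      exact Finset.sum_congr rfl fun u _ => by ring
    rw [h1, h2, h3, h4]
    simp only [blockLaw]
    rcases (hPU.1 u).eq_or_lt with hu | hu
    · simp [← hu]
    rcases (harvestProb_nonneg hK h e).eq_or_lt with he | he
    · simp [← he]
    -- Only the common factor `PU u` times the square of the harvest probability must be nonzero;
    -- vanishing output probabilities need no separate case.
    have : PU u * ch.harvestProb K h e * ch.outputProb u ch.fullBattery e y *
        ch.harvestProb K h e / (PU u * ch.harvestProb K h e * (ch.harvestProb K h e *
          mixLaw PU (fun u => ch.outputProb u ch.fullBattery e) y)) =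
        ch.outputProb u ch.fullBattery e y /
          mixLaw PU (fun u => ch.outputProb u ch.fullBattery e) y := by
      rw [show PU u * ch.harvestProb K h e * ch.outputProb u ch.fullBattery e y *
        ch.harvestProb K h e = (PU u * ch.harvestProb K h e * ch.harvestProb K h e) *
          ch.outputProb u ch.fullBattery e y by ring, ← mul_assoc,
        mul_div_mul_left _ _ (by positivity)]
    rw [this]
    ring
  simp only [blockInfo, condMutualInfo, Fintype.sum_prod_type, key, klSum, Finset.mul_sum]
  rw [Finset.sum_comm]

/-! ### The maxima are attained -/

/-- A finite union, over the histories, of continuous images of a simplex. -/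
theorem isCompact_barSet (hK : ch.IsHarvestKernel K) (N : ℕ) : IsCompact (ch.barSet K N) := by
  have h : ch.barSet K N = ⋃ h : Fin r → ch.harvest,
      (fun PU => 1 / (N : ℝ) * ch.blockInfo K PU h) '' stdSimplex ℝ (ch.InputFun N) := by
    ext c
    simp only [barSet, Set.mem_ofPred_eq, Set.mem_iUnion, Set.mem_image]
    constructor
    · rintro ⟨PU, hPU, h, rfl⟩
      exact ⟨h, PU, hPU, rfl⟩
    · rintro ⟨h, PU, hPU, rfl⟩
      exact ⟨PU, hPU, h, rfl⟩
  rw [h]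
  refine isCompact_iUnion fun h => (isCompact_stdSimplex ℝ _).image_of_continuousOn ?_
  refine continuousOn_const.mul ?_
  refine (continuousOn_condMutualInfo _ _ _).comp (Continuous.continuousOn ?_)
    fun PU hPU => blockLaw_nonneg hK hPU.1 h
  unfold blockLaw
  fun_prop

theorem barSet_nonempty [Nonempty ch.harvest] (N : ℕ) : (ch.barSet K N).Nonempty := by
  classical
  obtain ⟨u⟩ : Nonempty (ch.InputFun N) := inferInstance
  exact ⟨_, Pi.single u 1, single_mem_stdSimplex ℝ u, fun _ => Classical.arbitrary _, rfl⟩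

theorem isGreatest_barC [Nonempty ch.harvest] (hK : ch.IsHarvestKernel K) (N : ℕ) :
    IsGreatest (ch.barSet K N) (ch.barC K N) :=
  (isCompact_barSet hK N).isGreatest_sSup (barSet_nonempty N)

theorem pathLaw_nonneg (hK : ch.IsHarvestKernel K) {N : ℕ} {π : ch.State r → ℝ}
    (hπ : ∀ z, 0 ≤ π z) {p : Fin N → ch.State r → 𝒳 → ℝ} (hp : ∀ n, p n ∈ ch.legalInputs r)
    (t : ch.Path r N) : 0 ≤ ch.pathLaw K π p t :=
  mul_nonneg (hπ _) (Finset.prod_nonneg fun n _ =>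
    mul_nonneg ((hp n _).1.1 _) (stepProb_nonneg hK _ _ _ _ _))

theorem isCompact_legalInputs (r : ℕ) : IsCompact (ch.legalInputs r) := by
  have h : ch.legalInputs r = Set.pi Set.univ (fun _ : ch.State r => stdSimplex ℝ 𝒳) ∩
      ⋂ (z : ch.State r) (x : 𝒳) (_ : (z.2 : ℕ) < ch.cost x), {p | p z x = 0} := by
    ext p
    simp only [legalInputs, Set.mem_ofPred_eq, Set.mem_inter_iff, Set.mem_pi, Set.mem_univ,
      true_imp_iff, Set.mem_iInter, forall_and]
  rw [h]
  refine (isCompact_univ_pi fun _ => isCompact_stdSimplex ℝ _).inter_right ?_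
  refine isClosed_iInter fun z => isClosed_iInter fun x => isClosed_iInter fun _ => ?_
  exact isClosed_eq (by fun_prop) continuous_const

theorem isCompact_tildeSet (hK : ch.IsHarvestKernel K) (N : ℕ) {π : ch.State r → ℝ}
    (hπ : ∀ z, 0 ≤ π z) : IsCompact (ch.tildeSet K N π) := by
  have h : ch.tildeSet K N π = (fun p => ch.sumInfo K π p) ''
      Set.pi Set.univ (fun _ : Fin N => ch.legalInputs r) := by
    ext c
    simp only [tildeSet, Set.mem_ofPred_eq, Set.mem_image, Set.mem_pi, Set.mem_univ, true_imp_iff,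
      eq_comm]
  rw [h]
  refine (isCompact_univ_pi fun _ => isCompact_legalInputs r).image_of_continuousOn ?_
  unfold sumInfo
  refine continuousOn_finsetSum _ fun n _ => ?_
  refine (continuousOn_condMutualInfo _ _ _).comp (Continuous.continuousOn ?_)
    fun p hp => pathLaw_nonneg hK hπ fun n => hp n (Set.mem_univ n)
  unfold pathLaw
  fun_prop

theorem legalInputs_nonempty (r : ℕ) : (ch.legalInputs r).Nonempty := by
  classical
  refine ⟨fun _ => Pi.single 0 1, fun z => ⟨single_mem_stdSimplex ℝ 0, fun x hx => ?_⟩⟩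
  change (Pi.single 0 1 : 𝒳 → ℝ) x = 0
  rw [Pi.single_eq_of_ne]
  rintro rfl
  simp [ch.cost_zero] at hx

theorem isGreatest_tildec (hK : ch.IsHarvestKernel K) (N : ℕ) {π : ch.State r → ℝ}
    (hπ : ∀ z, 0 ≤ π z) : IsGreatest (ch.tildeSet K N π) (ch.tildec K N π) := by
  obtain ⟨p, hp⟩ := ch.legalInputs_nonempty r
  exact (isCompact_tildeSet hK N hπ).isGreatest_sSup ⟨_, fun _ => p, fun _ => hp, rfl⟩

end

end EHChannel

namespace EHChannel

variable {𝒳 𝒴 : Type*} [Zero 𝒳] [Fintype 𝒴] {ch : EHChannel 𝒳 𝒴}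

/-! ### The path law -/

section
variable {r : ℕ} {K : (Fin r → ch.harvest) → ch.harvest → ℝ}

/-- The joint law of state, input, output, next harvested energy and next state. -/
noncomputable def stepLaw (K : (Fin r → ch.harvest) → ch.harvest → ℝ) (π : ch.State r → ℝ)
    (p : ch.State r → 𝒳 → ℝ) (t : ch.State r × 𝒳 × 𝒴 × ch.harvest × ch.State r) : ℝ :=
  π t.1 * p t.1 t.2.1 * ch.stepProb K t.2.1 t.1 t.2.2.1 t.2.2.2.1 t.2.2.2.2

variable (ch r) in
/-- A path is its first step followed by the rest of the path. -/
def pathEquiv (N : ℕ) :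
    (ch.State r × 𝒳 × 𝒴 × ch.harvest) × ch.Path r N ≃ ch.Path r (N + 1) where
  toFun t := (Fin.cons t.1.1 t.2.1, Fin.cons t.1.2.1 t.2.2.1, Fin.cons t.1.2.2.1 t.2.2.2.1,
    Fin.cons t.1.2.2.2 t.2.2.2.2)
  invFun t := ((t.1 0, t.2.1 0, t.2.2.1 0, t.2.2.2 0),
    (Fin.tail t.1, Fin.tail t.2.1, Fin.tail t.2.2.1, Fin.tail t.2.2.2))
  left_inv t := by simp
  right_inv t := by simp

/-- Given its first step, the rest of a path follows the path law started from an unnormalized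
measure on the next state. The path law is linear in the initial measure, so summing over first
steps turns this measure into `nextLaw`. -/
theorem pathLaw_pathEquiv {N : ℕ} (π : ch.State r → ℝ) (p : Fin (N + 1) → ch.State r → 𝒳 → ℝ)
    (s : ch.State r × 𝒳 × 𝒴 × ch.harvest) (t : ch.Path r N) :
    ch.pathLaw K π p (ch.pathEquiv r N (s, t)) =
      ch.pathLaw K (fun z' => ch.stepLaw K π (p 0) (s.1, s.2.1, s.2.2.1, s.2.2.2, z'))
        (Fin.tail p) t := by
  simp [pathLaw, pathEquiv, Fin.prod_univ_succ, stepLaw, Fin.tail, mul_assoc]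

theorem sum_stepProb (hK : ch.IsHarvestKernel K) (x : 𝒳) (z : ch.State r) :
    ∑ y, ∑ e, ∑ z', ch.stepProb K x z y e z' = 1 := by
  simp only [stepProb, mul_ite, mul_one, mul_zero, Finset.sum_ite_eq',
    Finset.mem_univ, if_true, ← Finset.mul_sum, (hK _).2]
  exact ch.sum_W x

variable [Fintype 𝒳]

/-- The law of the next state if the state has law `π` and the input has conditional law `p`. -/
noncomputable def nextLaw (K : (Fin r → ch.harvest) → ch.harvest → ℝ) (π : ch.State r → ℝ)
    (p : ch.State r → 𝒳 → ℝ) (z' : ch.State r) : ℝ :=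
  ∑ z, ∑ x, ∑ y, ∑ e, π z * p z x * ch.stepProb K x z y e z'

/-- One term of `sumInfo`, for the state law `π` and the input law `p`. -/
noncomputable def stepInfo (K : (Fin r → ch.harvest) → ch.harvest → ℝ) (π : ch.State r → ℝ)
    (p : ch.State r → 𝒳 → ℝ) : ℝ :=
  condMutualInfo (ch.stepLaw K π p) (fun t => t.2.2) (fun t => t.2.1) (fun t => t.1)

theorem sum_path_succ {N : ℕ} (f : ch.Path r (N + 1) → ℝ) :
    ∑ t, f t = ∑ s, ∑ t, f (ch.pathEquiv r N (s, t)) := by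
  rw [← (ch.pathEquiv r N).sum_comp, Fintype.sum_prod_type]

theorem sum_pathLaw_pathEquiv {N : ℕ} (π : ch.State r → ℝ)
    (p : Fin (N + 1) → ch.State r → 𝒳 → ℝ) (t : ch.Path r N) :
    ∑ s, ch.pathLaw K π p (ch.pathEquiv r N (s, t)) =
      ch.pathLaw K (ch.nextLaw K π (p 0)) (Fin.tail p) t := by
  simp only [pathLaw_pathEquiv]
  simp only [pathLaw, ← Finset.sum_mul, nextLaw, stepLaw, Fintype.sum_prod_type]

theorem sum_nextLaw (hK : ch.IsHarvestKernel K) (π : ch.State r → ℝ) {p : ch.State r → 𝒳 → ℝ}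
    (hp : p ∈ ch.legalInputs r) : ∑ z, ch.nextLaw K π p z = ∑ z, π z := by
  unfold nextLaw
  rw [Finset.sum_comm]
  refine Finset.sum_congr rfl fun z _ => ?_
  rw [Finset.sum_comm]
  calc ∑ x, ∑ z', ∑ y, ∑ e, π z * p z x * ch.stepProb K x z y e z' = ∑ x, π z * p z x := by
        refine Finset.sum_congr rfl fun x _ => ?_
        rw [Finset.sum_comm]
        conv_lhs => enter [2, y]; rw [Finset.sum_comm]
        simp only [← Finset.mul_sum, sum_stepProb hK, mul_one]
    _ = π z := by rw [← Finset.mul_sum, (hp z).1.2, mul_one]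

theorem sum_pathLaw (hK : ch.IsHarvestKernel K) {N : ℕ} (π : ch.State r → ℝ)
    {p : Fin N → ch.State r → 𝒳 → ℝ} (hp : ∀ n, p n ∈ ch.legalInputs r) :
    ∑ t, ch.pathLaw K π p t = ∑ z, π z := by
  induction N generalizing π with
  | zero =>
    simp only [Fintype.sum_prod_type (α₁ := Fin (0 + 1) → ch.State r)]
    simp [pathLaw]
    exact (Equiv.funUnique (Fin 1) (ch.State r)).sum_comp π
  | succ N ih =>
    rw [sum_path_succ, Finset.sum_comm]
    simp only [sum_pathLaw_pathEquiv]
    rw [ih (p := Fin.tail p) _ fun n => hp n.succ, sum_nextLaw hK π (hp 0)]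

theorem finProb_pathLaw_tail {N : ℕ} (π : ch.State r → ℝ)
    (p : Fin (N + 1) → ch.State r → 𝒳 → ℝ) :
    (fun t' : ch.Path r N => finProb (ch.pathLaw K π p)
      fun t => ((ch.pathEquiv r N).symm t).2 = t') =
      ch.pathLaw K (ch.nextLaw K π (p 0)) (Fin.tail p) := by
  classical
  funext t'
  rw [finProb_eq_sum_ite, sum_path_succ]
  rw [Finset.sum_comm, ← sum_pathLaw_pathEquiv]
  simp only [Equiv.symm_apply_apply]
  rw [Finset.sum_eq_single t' (fun t _ ht => by simp [ht]) (by simp)]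
  simp only [if_true]

theorem finProb_pathLaw_head (hK : ch.IsHarvestKernel K) {N : ℕ} (π : ch.State r → ℝ)
    {p : Fin (N + 1) → ch.State r → 𝒳 → ℝ} (hp : ∀ n, p n ∈ ch.legalInputs r) :
    (fun s : ch.State r × 𝒳 × 𝒴 × ch.harvest × ch.State r => finProb (ch.pathLaw K π p)
      fun t => (t.1 0, t.2.1 0, t.2.2.1 0, t.2.2.2 0, t.1 1) = s) =
      ch.stepLaw K π (p 0) := by
  classical
  funext ⟨z, x, y, e, z'⟩
  rw [finProb_eq_sum_ite, sum_path_succ]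
  -- The event fixes the first step and the second state `z'`. What remains is a path law started
  -- from a point mass at `z'` of size `stepLaw`, and its total mass is that of its initial measure.
  have h1 : ∀ s t, (if (((ch.pathEquiv r N (s, t)).1 0, (ch.pathEquiv r N (s, t)).2.1 0,
      (ch.pathEquiv r N (s, t)).2.2.1 0, (ch.pathEquiv r N (s, t)).2.2.2 0,
      (ch.pathEquiv r N (s, t)).1 1) = (z, x, y, e, z'))
      then ch.pathLaw K π p (ch.pathEquiv r N (s, t)) else 0) =
      if s = (z, x, y, e) then ch.pathLaw K (fun w => if w = z' then
        ch.stepLaw K π (p 0) (z, x, y, e, w) else 0) (Fin.tail p) t else 0 := by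
    intro s t
    rw [pathLaw_pathEquiv]
    obtain ⟨a, b, c, d⟩ := s
    have h2 : (ch.pathEquiv r N ((a, b, c, d), t)).1 1 = t.1 0 := by
      change (Fin.cons a t.1 : Fin (N + 2) → ch.State r) (Fin.succ 0) = _
      rw [Fin.cons_succ]
    rw [h2]
    simp only [pathEquiv, Equiv.coe_fn_mk, Fin.cons_zero, Prod.mk.injEq]
    by_cases h : a = z ∧ b = x ∧ c = y ∧ d = e
    · obtain ⟨rfl, rfl, rfl, rfl⟩ := h
      by_cases h' : t.1 0 = z' <;> simp [h', pathLaw]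
    · rw [if_neg h, if_neg fun h' => h ⟨h'.1, h'.2.1, h'.2.2.1, h'.2.2.2.1⟩]
  simp only [h1]
  rw [Finset.sum_comm]
  simp only [Finset.sum_ite_eq', Finset.mem_univ, if_true]
  rw [sum_pathLaw (p := Fin.tail p) hK _ fun n => hp n.succ]
  simp

/-- The recursion for `sumInfo` obtained by splitting off the first step. -/
theorem sumInfo_succ (hK : ch.IsHarvestKernel K) {N : ℕ} (π : ch.State r → ℝ)
    {p : Fin (N + 1) → ch.State r → 𝒳 → ℝ} (hp : ∀ n, p n ∈ ch.legalInputs r) :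
    ch.sumInfo K π p =
      ch.stepInfo K π (p 0) + ch.sumInfo K (ch.nextLaw K π (p 0)) (Fin.tail p) := by
  unfold sumInfo
  rw [Fin.sum_univ_succ, stepInfo, ← finProb_pathLaw_head hK π hp]
  congr 1
  · exact condMutualInfo_comp (ch.pathLaw K π p)
      (fun t => (t.1 0, t.2.1 0, t.2.2.1 0, t.2.2.2 0, t.1 1)) (fun t => t.2.2) (fun t => t.2.1)
      (fun t => t.1)
  · refine Finset.sum_congr rfl fun n _ => ?_
    rw [← finProb_pathLaw_tail]
    exact condMutualInfo_comp (ch.pathLaw K π p) (fun t => ((ch.pathEquiv r N).symm t).2)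
      (fun t => (t.2.2.1 n, t.2.2.2 n, t.1 n.succ)) (fun t => t.2.1 n) (fun t => t.1 n.castSucc)

open Classical in
/-- The probability of output `y` and next state `z'` given the state `z` and the next harvested
energy `e`, for the input law `p`. -/
noncomputable def outNextProb (p : ch.State r → 𝒳 → ℝ) (z : ch.State r) (e : ch.harvest) (y : 𝒴)
    (z' : ch.State r) : ℝ :=
  ∑ x, p z x * ch.W x y * if z' = ch.nextState z x e then 1 else 0

theorem sum_step (f : ch.State r × 𝒳 × 𝒴 × ch.harvest × ch.State r → ℝ) :
    ∑ t, f t = ∑ z, ∑ x, ∑ y, ∑ e, ∑ z', f (z, x, y, e, z') := by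
  simp only [Fintype.sum_prod_type (α₁ := ch.State r), Fintype.sum_prod_type (α₁ := 𝒳),
    Fintype.sum_prod_type (α₁ := 𝒴), Fintype.sum_prod_type (α₁ := ch.harvest)]

/-- The next state is a function of `(z, x, e)`, and `e` is independent of `(x, y)` given `z`. Hence
only one value `z'` contributes and the factor `K` cancels inside the logarithm. -/
theorem stepInfo_eq (hK : ch.IsHarvestKernel K) {π : ch.State r → ℝ} (hπ : ∀ z, 0 ≤ π z)
    {p : ch.State r → 𝒳 → ℝ} (hp : p ∈ ch.legalInputs r) :
    ch.stepInfo K π p = ∑ t : ch.State r × 𝒳, π t.1 * p t.1 t.2 * ∑ e, K t.1.1 e *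
      klSum (ch.W t.2) (fun y => outNextProb p t.1 e y (ch.nextState t.1 t.2 e)) := by
  classical
  have key : ∀ (z : ch.State r) (x : 𝒳) (y : 𝒴) (e : ch.harvest) (z' : ch.State r),
      ch.stepLaw K π p (z, x, y, e, z') * Real.log
        (finProb (ch.stepLaw K π p) (fun t => t.2.2 = (y, e, z') ∧ t.2.1 = x ∧ t.1 = z) *
            finProb (ch.stepLaw K π p) (fun t => t.1 = z) /
          (finProb (ch.stepLaw K π p) (fun t => t.2.2 = (y, e, z') ∧ t.1 = z) *
            finProb (ch.stepLaw K π p) (fun t => t.2.1 = x ∧ t.1 = z))) =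
      if z' = ch.nextState z x e then π z * p z x * (K z.1 e * (ch.W x y *
        Real.log (ch.W x y / outNextProb p z e y (ch.nextState z x e)))) else 0 := by
    intro z x y e z'
    have h1 : finProb (ch.stepLaw K π p) (fun t => t.2.2 = (y, e, z') ∧ t.2.1 = x ∧ t.1 = z) =
        π z * p z x * ch.stepProb K x z y e z' := by
      simp [finProb_eq_sum_ite, sum_step, ite_and, stepLaw]
    have h2 : finProb (ch.stepLaw K π p) (fun t => t.1 = z) = π z := by
      simp [finProb_eq_sum_ite, sum_step, stepLaw, ← Finset.mul_sum,
        -Finset.univ_eq_attach,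
        sum_stepProb hK, Finset.sum_ite_irrel, (hp z).1.2]
    have h3 : finProb (ch.stepLaw K π p) (fun t => t.2.2 = (y, e, z') ∧ t.1 = z) =
        π z * (K z.1 e * outNextProb p z e y z') := by
      simp [finProb_eq_sum_ite, sum_step, stepLaw, ite_and, outNextProb,
        Finset.mul_sum, stepProb]
      refine Finset.sum_congr rfl fun x _ => ?_
      split_ifs <;> ring
    have h4 : finProb (ch.stepLaw K π p) (fun t => t.2.1 = x ∧ t.1 = z) = π z * p z x := by
      simp [finProb_eq_sum_ite, sum_step, stepLaw, ← Finset.mul_sum,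
        -Finset.univ_eq_attach,
        sum_stepProb hK, ite_and, Finset.sum_ite_irrel]
    rw [h1, h2, h3, h4]
    simp only [stepLaw, stepProb]
    by_cases hz : z' = ch.nextState z x e
    swap
    · simp [hz]
    subst hz
    simp only [if_true, mul_one]
    rcases (hπ z).eq_or_lt with h | h
    · simp [← h]
    rcases ((hp z).1.1 x).eq_or_lt with h' | h'
    · simp [← h']
    rcases ((hK z.1).1 e).eq_or_lt with h'' | h''
    · simp [← h'']
    have : π z * p z x * (ch.W x y * K z.1 e) * π z /
        (π z * (K z.1 e * outNextProb p z e y (ch.nextState z x e)) * (π z * p z x)) =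
        ch.W x y / outNextProb p z e y (ch.nextState z x e) := by
      rw [show π z * p z x * (ch.W x y * K z.1 e) * π z =
          (π z * p z x * K z.1 e * π z) * ch.W x y by ring,
        show π z * (K z.1 e * outNextProb p z e y (ch.nextState z x e)) * (π z * p z x) =
          (π z * p z x * K z.1 e * π z) * outNextProb p z e y (ch.nextState z x e) by ring,
        mul_div_mul_left _ _ (by positivity)]
    rw [this]
    ring
  simp only [stepInfo, condMutualInfo, sum_step, key]
  simp only [Fintype.sum_prod_type (α₁ := ch.State r), klSum, Finset.mul_sum, Finset.sum_ite_eq', Finset.mem_univ, if_true]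
  exact Finset.sum_congr rfl fun z _ => Finset.sum_congr rfl fun x _ => Finset.sum_comm

end

end EHChannel

namespace EHChannel

variable {𝒳 𝒴 : Type*} [Zero 𝒳] [Fintype 𝒴] {ch : EHChannel 𝒳 𝒴}

/-! ### Delayed causal functions -/

section
variable {r : ℕ} {K : (Fin r → ch.harvest) → ch.harvest → ℝ}

variable (ch) in
/-- Functions of the harvested energies that know the energies before time `n` only. In their use,
`e n` is harvested after the `n`-th transmission. -/
abbrev DelayedFun (N : ℕ) : Type _ := (n : Fin N) → (Fin n.val → ch.harvest) → 𝒳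

/-- The inputs that the delayed functions `v` produce from `e`. -/
def DelayedFun.run {N : ℕ} (v : ch.DelayedFun N) (e : Fin N → ch.harvest) : Fin N → 𝒳 :=
  fun n => v n fun i => e ⟨i.val, by omega⟩

/-- The first input. -/
def DelayedFun.head {N : ℕ} (v : ch.DelayedFun (N + 1)) : 𝒳 := v 0 Fin.elim0

/-- The delayed functions that remain after the first step. -/
def DelayedFun.after {N : ℕ} (v : ch.DelayedFun (N + 1)) (e₀ : ch.harvest) : ch.DelayedFun N :=
  fun n a => v n.succ (Fin.cons e₀ a : Fin (n.val + 1) → ch.harvest)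

theorem DelayedFun.run_zero {N : ℕ} (v : ch.DelayedFun (N + 1)) (e : Fin (N + 1) → ch.harvest) :
    DelayedFun.run v e 0 = DelayedFun.head v :=
  congrArg (v 0) (funext fun i => i.elim0)

theorem DelayedFun.tail_run {N : ℕ} (v : ch.DelayedFun (N + 1)) (e₀ : ch.harvest)
    (e : Fin N → ch.harvest) :
    Fin.tail (DelayedFun.run v (Fin.cons e₀ e : Fin (N + 1) → ch.harvest)) =
      DelayedFun.run (DelayedFun.after v e₀) e := by
  funext n
  refine congrArg (v n.succ) (funext fun i => ?_)
  revert i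
  exact Fin.cases rfl fun i => rfl

variable (ch) in
/-- The energy constraint when the energy `s` is available for the first transmission. -/
def Feasible : (N : ℕ) → ℕ → (Fin N → ch.harvest) → (Fin N → 𝒳) → Prop
  | 0, _, _, _ => True
  | N + 1, s, e, x => ch.cost (x 0) ≤ s ∧
      Feasible N (ch.S (ch.nextBattery s (x 0)) (e 0)) (Fin.tail e) (Fin.tail x)

/-- The regrouping pairs each transmission with the energy harvested after it: `e 0` goes into the
initial state, and `Fin.tail e` supplies the later ones. Its last entry follows the final
transmission and constrains nothing. -/
theorem EnergyConstraint.feasible {N : ℕ} {b : ch.Battery} {e : Fin (N + 1) → ch.harvest}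
    {x : Fin N → 𝒳} (h : ch.EnergyConstraint b (Fin.init e) x) :
    ch.Feasible N (ch.S b (e 0)) (Fin.tail e) x := by
  induction N generalizing b with
  | zero => trivial
  | succ N ih =>
    rw [energyConstraint_succ] at h
    exact ⟨h.1, ih (b := ch.nextBattery (ch.S b (e 0)) (x 0)) (e := Fin.tail e) h.2⟩

/-- Once the first harvested energy is known, causal functions become delayed functions. -/
def CausalFun.toDelayed {N : ℕ} (u : ch.CausalFun N) (e₀ : ch.harvest) : ch.DelayedFun N :=
  fun n a => u n (Fin.cons e₀ a : Fin (n.val + 1) → ch.harvest)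

theorem CausalFun.run_toDelayed {N : ℕ} (u : ch.CausalFun N) (e₀ : ch.harvest)
    (e : Fin N → ch.harvest) :
    DelayedFun.run (CausalFun.toDelayed u e₀) e =
      ch.run u (Fin.init (Fin.cons e₀ e : Fin (N + 1) → ch.harvest)) := by
  funext n
  refine congrArg (u n) (funext fun i => ?_)
  revert i
  exact Fin.cases rfl fun i => rfl

open Classical in
/-- The conditional law of the input given the state in a family with weights `w`, states `z` and
inputs `x`. -/
noncomputable def condInput {I : Type*} [Fintype I] (w : I → ℝ) (z : I → ch.State r) (x : I → 𝒳) :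
    ch.State r → 𝒳 → ℝ :=
  -- At a state of weight zero the zero symbol is sent; it costs nothing, so the policy is legal at
  -- every state.
  fun s a => if ∑ i with z i = s, w i = 0 then Pi.single (M := fun _ => ℝ) 0 1 a else
    (∑ i with (z i, x i) = (s, a), w i) / ∑ i with z i = s, w i

open Classical in
theorem mul_condInput {I : Type*} [Fintype I] {w : I → ℝ} (hw : ∀ i, 0 ≤ w i)
    (z : I → ch.State r) (x : I → 𝒳) (s : ch.State r) (a : 𝒳) :
    (∑ i with z i = s, w i) * condInput w z x s a = ∑ i with (z i, x i) = (s, a), w i := by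
  unfold condInput
  split_ifs with h
  · rw [h, zero_mul, eq_comm]
    rw [Finset.sum_eq_zero_iff_of_nonneg fun i _ => hw i] at h
    refine Finset.sum_eq_zero fun i hi => h i ?_
    simp only [Finset.mem_filter, Prod.mk.injEq] at hi ⊢
    exact ⟨hi.1, hi.2.1⟩
  · field_simp

/-- The last step of the relaxed bound involves an energy harvested after the `N`-th transmission,
which the block information lacks; it is added here without effect. -/
theorem sum_harvestProb_init (hK : ch.IsHarvestKernel K) {N : ℕ} (h : Fin r → ch.harvest)
    (G : (Fin N → ch.harvest) → ℝ) :
    ∑ e : Fin (N + 1) → ch.harvest, ch.harvestProb K h e * G (Fin.init e) =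
      ∑ e, ch.harvestProb K h e * G e := by
  rw [sum_fin_add (n := 1)]
  refine Finset.sum_congr rfl fun e _ => ?_
  have h1 : ∀ a : Fin 1 → ch.harvest, Fin.init (Fin.append e a : Fin (N + 1) → ch.harvest) = e :=
    fun a => funext fun i => Fin.append_left e a i
  simp only [h1, harvestProb_append, ← Finset.sum_mul, ← Finset.mul_sum, sum_harvestProb hK,
    mul_one]

variable [Fintype 𝒳]

/-! ### The output law of a state-dependent input law -/

variable (ch) in
/-- The probability of the output word `y` if the inputs are drawn from `p`, starting from the state
`z`, and the energies `e` are harvested after each transmission. -/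
noncomputable def policyProb : (N : ℕ) → (Fin N → ch.State r → 𝒳 → ℝ) → ch.State r →
    (Fin N → ch.harvest) → (Fin N → 𝒴) → ℝ
  | 0, _, _, _, _ => 1
  | N + 1, p, z, e, y => ∑ x, p 0 z x * ch.W x (y 0) *
      policyProb N (Fin.tail p) (ch.nextState z x (e 0)) (Fin.tail e) (Fin.tail y)

theorem policyProb_nonneg {N : ℕ} {p : Fin N → ch.State r → 𝒳 → ℝ}
    (hp : ∀ n, p n ∈ ch.legalInputs r) (z : ch.State r) (e : Fin N → ch.harvest)
    (y : Fin N → 𝒴) : 0 ≤ ch.policyProb N p z e y := by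
  induction N generalizing z with
  | zero => exact zero_le_one
  | succ N ih =>
    exact Finset.sum_nonneg fun x _ => mul_nonneg (mul_nonneg ((hp 0 z).1.1 x) (ch.W_nonneg _ _))
      (ih (p := Fin.tail p) (fun n => hp n.succ) _ _ _)

theorem sum_policyProb {N : ℕ} {p : Fin N → ch.State r → 𝒳 → ℝ}
    (hp : ∀ n, p n ∈ ch.legalInputs r) (z : ch.State r) (e : Fin N → ch.harvest) :
    ∑ y, ch.policyProb N p z e y = 1 := by
  induction N generalizing z with
  | zero => simp [policyProb]
  | succ N ih =>
    rw [sum_fin_succ]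
    simp only [policyProb, Fin.cons_zero, Fin.tail_cons]
    calc _ = ∑ y₀, ∑ x, p 0 z x * ch.W x y₀ := by
          refine Finset.sum_congr rfl fun y₀ _ => ?_
          rw [Finset.sum_comm]
          simp only [← Finset.mul_sum, ih (p := Fin.tail p) (fun n => hp n.succ), mul_one]
      _ = 1 := by
          rw [Finset.sum_comm]
          simp only [← Finset.mul_sum, ch.sum_W, mul_one]
          exact (hp 0 z).1.2

/-- Only the inputs leading to the state `z'` are kept. The bound is a product, although the policy
law itself averages over all state trajectories. -/
theorem le_policyProb_succ {N : ℕ} {p : Fin (N + 1) → ch.State r → 𝒳 → ℝ}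
    (hp : ∀ n, p n ∈ ch.legalInputs r) (z z' : ch.State r) (e : Fin (N + 1) → ch.harvest)
    (y : Fin (N + 1) → 𝒴) :
    outNextProb (p 0) z (e 0) (y 0) z' *
      ch.policyProb N (Fin.tail p) z' (Fin.tail e) (Fin.tail y) ≤ ch.policyProb (N + 1) p z e y := by
  simp only [outNextProb, policyProb, Finset.sum_mul]
  refine Finset.sum_le_sum fun x _ => ?_
  by_cases h : z' = ch.nextState z x (e 0)
  · simp [h]
  · simp only [h, if_false, mul_zero, zero_mul]
    exact mul_nonneg (mul_nonneg ((hp 0 z).1.1 x) (ch.W_nonneg _ _))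
      (policyProb_nonneg (p := Fin.tail p) (fun n => hp n.succ) _ _ _)

theorem klSum_anti {Y : Type*} [Fintype Y] {V Q Q' : Y → ℝ} (hV : ∀ y, 0 ≤ V y)
    (hQ : ∀ y, Q' y ≤ Q y) (hVQ : ∀ y, 0 < V y → 0 < Q' y) : klSum V Q ≤ klSum V Q' := by
  refine Finset.sum_le_sum fun y _ => ?_
  rcases (hV y).eq_or_lt with h | h
  · simp [← h]
  have := hVQ y h
  gcongr
  · exact div_pos h (this.trans_le (hQ y))
  · exact hQ y

theorem klSum_cons {Y : Type*} [Fintype Y] {N : ℕ} (V Q : (Fin (N + 1) → Y) → ℝ) :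
    klSum V Q = klSum (fun y : Y × (Fin N → Y) => V (Fin.cons y.1 y.2))
      (fun y => Q (Fin.cons y.1 y.2)) := by
  simp only [klSum]
  rw [sum_fin_succ, Fintype.sum_prod_type]

/-! ### Markovization: a policy with the same state and input marginals. -/

theorem condInput_mem {I : Type*} [Fintype I] {w : I → ℝ} (hw : ∀ i, 0 ≤ w i)
    {z : I → ch.State r} {x : I → 𝒳} (hx : ∀ i, ch.cost (x i) ≤ (z i).2) :
    condInput w z x ∈ ch.legalInputs r := by
  classical
  intro s
  have hρ : 0 ≤ ∑ i with z i = s, w i := Finset.sum_nonneg fun i _ => hw i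
  by_cases h : ∑ i with z i = s, w i = 0
  · have h1 : condInput w z x s = Pi.single (M := fun _ => ℝ) 0 1 := by
      funext a
      simp [condInput, h]
    rw [h1]
    refine ⟨single_mem_stdSimplex ℝ 0, fun a ha => ?_⟩
    rw [Pi.single_eq_of_ne]
    rintro rfl
    simp [ch.cost_zero] at ha
  · refine ⟨⟨fun a => ?_, ?_⟩, fun a ha => ?_⟩
    · simp only [condInput, h, if_false]
      exact div_nonneg (Finset.sum_nonneg fun i _ => hw i) hρ
    · apply mul_left_cancel₀ h
      rw [Finset.mul_sum, mul_one]
      simp only [mul_condInput hw]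
      rw [← Finset.sum_fiberwise _ x]
      refine Finset.sum_congr rfl fun a _ => ?_
      rw [Finset.filter_filter]
      simp only [Prod.mk.injEq]
    · simp only [condInput, h, if_false]
      rw [Finset.sum_eq_zero, zero_div]
      intro i hi
      simp only [Finset.mem_filter, Prod.mk.injEq] at hi
      have := hx i
      rw [hi.2.1, hi.2.2] at this
      omega

-- The law of the next state depends only on the joint law of the current state and input, which
-- `condInput` reproduces. Thus the family and its policy keep the same state law.
open Classical in
theorem nextLaw_condInput {I : Type*} [Fintype I] {w : I → ℝ} (hw : ∀ i, 0 ≤ w i)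
    (z : I → ch.State r) (x : I → 𝒳) :
    ch.nextLaw K (fun s => ∑ i with z i = s, w i) (condInput w z x) =
      fun s => ∑ t : I × ch.harvest with ch.nextState (z t.1) (x t.1) t.2 = s,
        w t.1 * K (z t.1).1 t.2 := by
  funext s
  have h : ∀ (a : ch.State r × 𝒳), ∑ y, ∑ e, ch.stepProb K a.2 a.1 y e s =
      ∑ e, if ch.nextState a.1 a.2 e = s then K a.1.1 e else 0 := by
    intro a
    rw [Finset.sum_comm]
    refine Finset.sum_congr rfl fun e _ => ?_
    simp only [stepProb, ← Finset.sum_mul, ch.sum_W, one_mul, eq_comm (a := s)]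
    simp
  unfold nextLaw
  simp only [mul_condInput hw, ← Finset.mul_sum]
  rw [← Fintype.sum_prod_type' (f := fun a b => (∑ i with (z i, x i) = (a, b), w i) *
    ∑ y, ∑ e, ch.stepProb K b a y e s)]
  simp only [h]
  rw [sum_mul_comp_eq (fun i => (z i, x i)) fun a =>
    ∑ e, if ch.nextState a.1 a.2 e = s then K a.1.1 e else 0]
  rw [Finset.sum_filter, Fintype.sum_prod_type]
  simp only [Finset.mul_sum, mul_ite, mul_zero]

open Classical in
/-- The Markovization of a family of delayed functions: some state-dependent input laws satisfy the
relaxed bound. -/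
theorem exists_policy [Nonempty ch.harvest] (hK : ch.IsHarvestKernel K) {N : ℕ} {I : Type*}
    [Fintype I] {w : I → ℝ} (hw : ∀ i, 0 ≤ w i) (z : I → ch.State r) (v : I → ch.DelayedFun N)
    (hv : ∀ i e, ch.Feasible N (z i).2 e (DelayedFun.run (v i) e)) :
    ∃ p : Fin N → ch.State r → 𝒳 → ℝ, (∀ n, p n ∈ ch.legalInputs r) ∧
      (∀ i e y, 0 < w i → 0 < ch.harvestProb K (z i).1 e →
        0 < ch.wordProb (DelayedFun.run (v i) e) y → 0 < ch.policyProb N p (z i) e y) ∧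
      ∑ i, w i * ∑ e, ch.harvestProb K (z i).1 e *
        klSum (ch.wordProb (DelayedFun.run (v i) e)) (ch.policyProb N p (z i) e) ≤
          ch.sumInfo K (fun s => ∑ i with z i = s, w i) p := by
  induction N generalizing I with
  | zero =>
    refine ⟨fun n => n.elim0, fun n => n.elim0, fun _ _ _ _ _ _ => zero_lt_one, ?_⟩
    simp [sumInfo, klSum, policyProb, wordProb]
  | succ N ih =>
    let x : I → 𝒳 := fun i => DelayedFun.head (v i)
    -- The induction continues with the family indexed by a member and the energy harvested after
    -- its first transmission. Hence the index type and the unnormalized weights must be general.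
    let z' : I × ch.harvest → ch.State r := fun t => ch.nextState (z t.1) (x t.1) t.2
    let w' : I × ch.harvest → ℝ := fun t => w t.1 * K (z t.1).1 t.2
    let v' : I × ch.harvest → ch.DelayedFun N := fun t => DelayedFun.after (v t.1) t.2
    let p₀ := condInput w z x
    have hp₀ : p₀ ∈ ch.legalInputs r := condInput_mem hw fun i => by
      have := (hv i fun _ => Classical.arbitrary _).1
      rwa [DelayedFun.run_zero] at this
    obtain ⟨p', hp', hpos, hle⟩ := ih (w := w') (fun t => mul_nonneg (hw _) ((hK _).1 _)) z' v'
      fun t e => by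
        have := (hv t.1 (Fin.cons t.2 e)).2
        rwa [DelayedFun.run_zero, DelayedFun.tail_run, Fin.tail_cons, Fin.cons_zero] at this
    let p : Fin (N + 1) → ch.State r → 𝒳 → ℝ := Fin.cons p₀ p'
    have hp : ∀ n, p n ∈ ch.legalInputs r := Fin.cases hp₀ hp'
    -- The member `i` itself gives its own input positive weight in its own state, so the reference
    -- law is positive where needed.
    have hq : ∀ i e₀ y₀, 0 < w i → 0 < ch.W (x i) y₀ →
        0 < outNextProb p₀ (z i) e₀ y₀ (z' (i, e₀)) := by
      intro i e₀ y₀ hi hy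
      refine Finset.sum_pos' (fun a _ => mul_nonneg (mul_nonneg ((hp₀ _).1.1 _) (ch.W_nonneg _ _))
        (by split_ifs <;> simp)) ⟨x i, Finset.mem_univ _, ?_⟩
      simp only [z', if_true, mul_one]
      refine mul_pos ?_ hy
      have h1 : 0 < ∑ j with (z j, x j) = (z i, x i), w j :=
        Finset.sum_pos' (fun j _ => hw j) ⟨i, by simp, hi⟩
      rw [← mul_condInput hw] at h1
      exact pos_of_mul_pos_right h1 (Finset.sum_nonneg fun j _ => hw j)
    have hrun : ∀ i e₀ e y₀ y, ch.wordProb (DelayedFun.run (v i) (Fin.cons e₀ e)) (Fin.cons y₀ y) =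
        ch.W (x i) y₀ * ch.wordProb (DelayedFun.run (v' (i, e₀)) e) y := by
      intro i e₀ e y₀ y
      rw [wordProb_cons, DelayedFun.run_zero, DelayedFun.tail_run]
    have hlow : ∀ i e₀ e y₀ y, outNextProb p₀ (z i) e₀ y₀ (z' (i, e₀)) *
        ch.policyProb N p' (z' (i, e₀)) e y ≤
          ch.policyProb (N + 1) p (z i) (Fin.cons e₀ e) (Fin.cons y₀ y) := by
      intro i e₀ e y₀ y
      have := le_policyProb_succ hp (z i) (z' (i, e₀)) (Fin.cons e₀ e) (Fin.cons y₀ y)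
      simpa [p] using this
    refine ⟨p, hp, fun i e y hi he hy => ?_, ?_⟩
    · rw [← Fin.cons_self_tail e, harvestProb_cons] at he
      rw [← Fin.cons_self_tail e, ← Fin.cons_self_tail y, hrun] at hy
      rw [← Fin.cons_self_tail e, ← Fin.cons_self_tail y]
      have hk := pos_of_mul_pos_left he (harvestProb_nonneg hK _ _)
      have hh := pos_of_mul_pos_right he ((hK _).1 _)
      have hy0 := pos_of_mul_pos_left hy (ch.wordProb_nonneg _ _)
      have hy1 := pos_of_mul_pos_right hy (ch.W_nonneg _ _)
      refine (mul_pos (hq i _ _ hi hy0) ?_).trans_le (hlow i _ _ _ _)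
      exact hpos (i, e 0) _ _ (mul_pos hi hk) hh hy1
    · have hterm : ∀ i e₀ e, w i * (K (z i).1 e₀ * (ch.harvestProb K (ch.shiftWindow (z i).1 e₀) e *
          klSum (ch.wordProb (DelayedFun.run (v i) (Fin.cons e₀ e)))
            (ch.policyProb (N + 1) p (z i) (Fin.cons e₀ e)))) ≤
          w i * (K (z i).1 e₀ * (ch.harvestProb K (ch.shiftWindow (z i).1 e₀) e *
            (klSum (ch.W (x i)) (fun y => outNextProb p₀ (z i) e₀ y (z' (i, e₀))) +
              klSum (ch.wordProb (DelayedFun.run (v' (i, e₀)) e))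
                (ch.policyProb N p' (z' (i, e₀)) e)))) := by
        intro i e₀ e
        rcases (hw i).eq_or_lt with hi | hi
        · simp [← hi]
        rcases ((hK (z i).1).1 e₀).eq_or_lt with hk | hk
        · simp [← hk]
        rcases (harvestProb_nonneg hK (ch.shiftWindow (z i).1 e₀) e).eq_or_lt with hh | hh
        · simp [← hh]
        refine mul_le_mul_of_nonneg_left (mul_le_mul_of_nonneg_left
          (mul_le_mul_of_nonneg_left ?_ hh.le) hk.le) hi.le
        have hq2 : ∀ y, 0 < ch.wordProb (DelayedFun.run (v' (i, e₀)) e) y →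
            0 < ch.policyProb N p' (z' (i, e₀)) e y :=
          fun y hy => hpos (i, e₀) e y (mul_pos hi hk) hh hy
        -- The two one-step relative entropies are recombined into that of a product, which is
        -- compared with the policy law through the lower bound `hlow`.
        rw [← klSum_prod (ch.W_nonneg _) (ch.wordProb_nonneg _) (ch.sum_W _) (ch.sum_wordProb _)
          (fun y hy => hq i e₀ y hi hy) hq2, klSum_cons]
        simp only [hrun]
        refine klSum_anti (fun y => mul_nonneg (ch.W_nonneg _ _) (ch.wordProb_nonneg _ _))
          (fun y => hlow i e₀ e y.1 y.2) fun y hy => ?_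
        exact mul_pos (hq i e₀ _ hi (pos_of_mul_pos_left hy (ch.wordProb_nonneg _ _)))
          (hq2 _ (pos_of_mul_pos_right hy (ch.W_nonneg _ _)))
      rw [sumInfo_succ hK _ hp]
      have h1 : ch.stepInfo K (fun s => ∑ i with z i = s, w i) (p 0) =
          ∑ i, w i * ∑ e₀, K (z i).1 e₀ *
            klSum (ch.W (x i)) (fun y => outNextProb p₀ (z i) e₀ y (z' (i, e₀))) := by
        rw [show p 0 = p₀ from rfl,
          stepInfo_eq hK (fun s => Finset.sum_nonneg fun i _ => hw i) hp₀]
        -- The one-step term depends on `i` only through its state and input, whose joint law is the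
        -- state law times `p₀`.
        simp only [p₀, mul_condInput hw]
        exact sum_mul_comp_eq (w := w) (fun i => (z i, x i)) fun t => ∑ e, K t.1.1 e *
          klSum (ch.W t.2) (fun y => outNextProb (condInput w z x) t.1 e y
            (ch.nextState t.1 t.2 e))
      have h2 : ch.nextLaw K (fun s => ∑ i with z i = s, w i) (p 0) =
          fun s => ∑ t with z' t = s, w' t := nextLaw_condInput hw z x
      rw [h1, h2, show Fin.tail p = p' from Fin.tail_cons _ _]
      refine le_trans ?_ (add_le_add_right hle _)
      rw [Fintype.sum_prod_type, ← Finset.sum_add_distrib]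
      refine Finset.sum_le_sum fun i _ => ?_
      rw [sum_fin_succ]
      simp only [harvestProb_cons, w', mul_assoc, ← Finset.mul_sum, ← mul_add,
        ← Finset.sum_add_distrib]
      rw [Finset.mul_sum, Finset.mul_sum]
      refine Finset.sum_le_sum fun e₀ _ => ?_
      rw [Finset.mul_sum, Finset.mul_sum]
      refine (Finset.sum_le_sum fun e _ => hterm i e₀ e).trans (le_of_eq ?_)
      rw [← Finset.mul_sum, ← Finset.mul_sum]
      simp only [mul_add, Finset.sum_add_distrib, ← Finset.sum_mul, sum_harvestProb hK, one_mul]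
      rfl

-- Conditioning on the first energy `e₀` turns a causal function into a delayed one with a definite
-- initial state. The pairs `(u, e₀)` form the family to be Markovized; as `u` and `e₀` are
-- independent, its state law is `initLaw`.
open Classical in
theorem blockInfo_le_tildec [Nonempty ch.harvest] (hK : ch.IsHarvestKernel K) {N : ℕ}
    {PU : ch.InputFun N → ℝ} (hPU : PU ∈ stdSimplex ℝ (ch.InputFun N)) (h : Fin r → ch.harvest) :
    ch.blockInfo K PU h ≤ ch.tildec K N (ch.initLaw K ch.fullBattery h) := by
  let z : ch.harvest → ch.State r :=
    fun e₀ => (ch.shiftWindow h e₀, ch.energyState ch.fullBattery e₀)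
  let v : ch.InputFun N → ch.harvest → ch.DelayedFun N :=
    fun u e₀ => CausalFun.toDelayed (fun n => u.1 n ch.fullBattery) e₀
  have hw : ∀ t : ch.InputFun N × ch.harvest, 0 ≤ PU t.1 * K h t.2 :=
    fun t => mul_nonneg (hPU.1 _) ((hK h).1 _)
  obtain ⟨p, hp, hpos, hle⟩ := exists_policy hK hw (fun t => z t.2) (fun t => v t.1 t.2)
    fun t e => by
      have h1 := t.1.2 ch.fullBattery (Fin.init (Fin.cons t.2 e : Fin (N + 1) → ch.harvest))
      have h2 := h1.feasible
      simp only [v, CausalFun.run_toDelayed]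
      exact h2
  have hlaw : (fun s => ∑ t : ch.InputFun N × ch.harvest with z t.2 = s, PU t.1 * K h t.2) =
      ch.initLaw K ch.fullBattery h := by
    funext s
    rw [Finset.sum_filter, Fintype.sum_prod_type, Finset.sum_comm]
    refine Finset.sum_congr rfl fun e _ => ?_
    simp only [eq_comm (b := s)]
    by_cases hs : s = z e
    · rw [if_pos hs]
      simp [hs, z, ← Finset.sum_mul, hPU.2]
    · rw [if_neg hs]
      simp [hs]
  have hV : ∀ u e₀ e, ch.outputProb u ch.fullBattery
      (Fin.init (Fin.cons e₀ e : Fin (N + 1) → ch.harvest)) =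
        ch.wordProb (DelayedFun.run (v u e₀) e) := by
    intro u e₀ e
    simp only [v, CausalFun.run_toDelayed]
    rfl
  have hπ : ∀ s, 0 ≤ ch.initLaw K ch.fullBattery h s := fun s =>
    Finset.sum_nonneg fun e _ => by
      split_ifs
      · exact (hK h).1 e
      · exact le_rfl
  rw [hlaw] at hle
  refine le_trans (le_trans ?_ hle) ((isGreatest_tildec hK N hπ).2 ⟨p, hp, rfl⟩)
  rw [blockInfo_eq hK hPU, ← sum_harvestProb_init hK, sum_fin_succ, Fintype.sum_prod_type_right]
  refine Finset.sum_le_sum fun e₀ _ => ?_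
  simp only [harvestProb_cons, hV]
  calc _ ≤ ∑ e, K h e₀ * ch.harvestProb K (ch.shiftWindow h e₀) e * ∑ u, PU u *
          klSum (ch.wordProb (DelayedFun.run (v u e₀) e)) (ch.policyProb N p (z e₀) e) := by
        refine Finset.sum_le_sum fun e _ => ?_
        rcases ((hK h).1 e₀).eq_or_lt with hk | hk
        · simp [← hk]
        rcases (harvestProb_nonneg hK (ch.shiftWindow h e₀) e).eq_or_lt with hh | hh
        · simp [← hh]
        refine mul_le_mul_of_nonneg_left ?_ (mul_pos hk hh).le
        -- For fixed energies the true output mixture is replaced by the policy law, which can only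
        -- increase the average relative entropy.
        exact sum_klSum_mixLaw_le hPU.1 hPU.2 (fun _ => ch.wordProb_nonneg _)
          (fun _ => ch.sum_wordProb _) (policyProb_nonneg hp _ _) (sum_policyProb hp _ _).le
          fun u y hu hy => hpos (u, e₀) e y (mul_pos hu hk) hh hy
    _ = _ := by
        simp only [Finset.mul_sum]
        rw [Finset.sum_comm]
        refine Finset.sum_congr rfl fun u _ => Finset.sum_congr rfl fun e _ => ?_
        ring

theorem barC_le_tildeC [Nonempty ch.harvest] (hK : ch.IsHarvestKernel K) (N : ℕ) :
    ch.barC K N ≤ ch.tildeC K N := by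
  obtain ⟨PU, hPU, h, hc⟩ := (isGreatest_barC hK N).1
  rw [hc]
  refine mul_le_mul_of_nonneg_left ((blockInfo_le_tildec hK hPU h).trans ?_) (by positivity)
  exact le_ciSup (f := fun h => ch.tildec K N (ch.initLaw K ch.fullBattery h))
    (Set.finite_range _).bddAbove h

end

end EHChannel

namespace EHChannel

variable {𝒳 𝒴 : Type*} [Zero 𝒳] [Fintype 𝒴] {ch : EHChannel 𝒳 𝒴}

/-! ### Splitting causal functions into blocks -/

section
variable {r : ℕ} {K : (Fin r → ch.harvest) → ch.harvest → ℝ}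

/-- The first `m` of `m + n` causal functions. -/
def CausalFun.take {m n : ℕ} (u : ch.CausalFun (m + n)) : ch.CausalFun m :=
  fun i => u (Fin.castAdd n i)

/-- The last `n` of `m + n` causal functions, for given first `m` harvested energies. -/
def CausalFun.drop {m n : ℕ} (u : ch.CausalFun (m + n)) (e : Fin m → ch.harvest) :
    ch.CausalFun n :=
  fun j a => u (Fin.natAdd m j) (Fin.append e a : Fin (m + (j.val + 1)) → ch.harvest)

theorem CausalFun.run_append_castAdd {m n : ℕ} (u : ch.CausalFun (m + n)) (e₁ : Fin m → ch.harvest)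
    (e₂ : Fin n → ch.harvest) :
    (fun i => ch.run u (Fin.append e₁ e₂) (Fin.castAdd n i)) =
      ch.run (CausalFun.take u) e₁ := by
  funext i
  refine congrArg (u (Fin.castAdd n i)) (funext fun k => ?_)
  have hk := k.2
  simp only [upTo, append_apply, Fin.val_castAdd] at hk ⊢
  rw [dif_pos (by omega)]

theorem CausalFun.run_append_natAdd {m n : ℕ} (u : ch.CausalFun (m + n)) (e₁ : Fin m → ch.harvest)
    (e₂ : Fin n → ch.harvest) :
    (fun j => ch.run u (Fin.append e₁ e₂) (Fin.natAdd m j)) =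
      ch.run (CausalFun.drop u e₁) e₂ := by
  funext j
  refine congrArg (u (Fin.natAdd m j)) (funext fun k => ?_)
  have h1 := append_apply ch e₁ (ch.upTo e₂ j) k.val k.2
  refine Eq.trans ?_ h1.symm
  simp only [upTo, append_apply]

theorem CausalFun.wordProb_run_append {m n : ℕ} (u : ch.CausalFun (m + n))
    (e₁ : Fin m → ch.harvest) (e₂ : Fin n → ch.harvest) (y₁ : Fin m → 𝒴) (y₂ : Fin n → 𝒴) :
    ch.wordProb (ch.run u (Fin.append e₁ e₂)) (Fin.append y₁ y₂) =
      ch.wordProb (ch.run (CausalFun.take u) e₁) y₁ *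
        ch.wordProb (ch.run (CausalFun.drop u e₁) e₂) y₂ := by
  rw [wordProb_append, CausalFun.run_append_castAdd, CausalFun.run_append_natAdd]

/-- Causal functions that satisfy the energy constraint for a full initial battery. -/
def CausalFun.IsLegal {N : ℕ} (u : ch.CausalFun N) : Prop :=
  ∀ e, ch.EnergyConstraint ch.fullBattery e (ch.run u e)

theorem CausalFun.IsLegal.take [Nonempty ch.harvest] {m n : ℕ} {u : ch.CausalFun (m + n)}
    (hu : CausalFun.IsLegal u) : CausalFun.IsLegal (CausalFun.take u) := by
  intro e
  have h := (hu (Fin.append e fun _ => Classical.arbitrary _)).castAdd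
  rw [CausalFun.run_append_castAdd] at h
  simpa only [Fin.append_left] using h

/-- The battery level after the first `m` uses depends on the past, but a full battery is at least
as good. -/
theorem CausalFun.IsLegal.drop (hS : ∀ e : ch.harvest, Monotone fun b : ch.Battery => ch.S b e)
    {m n : ℕ} {u : ch.CausalFun (m + n)} (hu : CausalFun.IsLegal u) (e : Fin m → ch.harvest) :
    CausalFun.IsLegal (CausalFun.drop u e) := by
  intro e₂
  obtain ⟨b, h⟩ := (hu (Fin.append e e₂)).natAdd
  rw [CausalFun.run_append_natAdd] at h
  have h2 := h.full hS
  simpa only [Fin.append_right] using h2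

/-! ### Output laws with small average relative entropy -/

/-- There are output laws, depending on the harvested energies, from which the output laws of the
causal functions `u i` have average relative entropy at most `c`, when `i` has law `w` and the
harvested energies have law `P`. -/
def RedundancyLE {I : Type*} [Fintype I] {N : ℕ} (P : (Fin N → ch.harvest) → ℝ) (w : I → ℝ)
    (u : I → ch.CausalFun N) (c : ℝ) : Prop :=
  ∃ Q : (Fin N → ch.harvest) → (Fin N → 𝒴) → ℝ, (∀ e y, 0 ≤ Q e y) ∧ (∀ e, ∑ y, Q e y ≤ 1) ∧
    (∀ i e y, 0 < ch.wordProb (ch.run (u i) e) y → 0 < Q e y) ∧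
    ∑ e, P e * ∑ i, w i * klSum (ch.wordProb (ch.run (u i) e)) (Q e) ≤ c

variable {I : Type*} [Fintype I] {w : I → ℝ}

theorem klSum_append {Y : Type*} [Fintype Y] {m n : ℕ} (V Q : (Fin (m + n) → Y) → ℝ) :
    klSum V Q = klSum (fun y : (Fin m → Y) × (Fin n → Y) => V (Fin.append y.1 y.2))
      (fun y => Q (Fin.append y.1 y.2)) := by
  simp only [klSum]
  rw [sum_fin_add, Fintype.sum_prod_type]

/-- For fixed energies the output law of each codeword is a product, so relative entropies to a
product reference law add. Since the reference laws are free, no conditioning on earlier outputs is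
required. -/
theorem RedundancyLE.append {m n : ℕ}
    {P : (Fin (m + n) → ch.harvest) → ℝ} {P₁ : (Fin m → ch.harvest) → ℝ}
    {P₂ : (Fin m → ch.harvest) → (Fin n → ch.harvest) → ℝ}
    (hP : ∀ e₁ e₂, P (Fin.append e₁ e₂) = P₁ e₁ * P₂ e₁ e₂) (hP₁ : ∀ e, 0 ≤ P₁ e)
    (hP₁1 : ∑ e, P₁ e = 1) (hP₂ : ∀ e, ∑ e₂, P₂ e e₂ = 1) {u : I → ch.CausalFun (m + n)}
    {c₁ c₂ : ℝ} (h₁ : RedundancyLE P₁ w (fun i => CausalFun.take (u i)) c₁)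
    (h₂ : ∀ e, RedundancyLE (P₂ e) w (fun i => CausalFun.drop (u i) e) c₂) :
    RedundancyLE P w u (c₁ + c₂) := by
  obtain ⟨Q₁, hQ₁, hQ₁1, hpos₁, hle₁⟩ := h₁
  choose Q₂ hQ₂ hQ₂1 hpos₂ hle₂ using h₂
  let Q : (Fin (m + n) → ch.harvest) → (Fin (m + n) → 𝒴) → ℝ := fun e y =>
    Q₁ (fun i => e (Fin.castAdd n i)) (fun i => y (Fin.castAdd n i)) *
      Q₂ (fun i => e (Fin.castAdd n i)) (fun j => e (Fin.natAdd m j)) (fun j => y (Fin.natAdd m j))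
  have hQ : ∀ e₁ e₂ y₁ y₂, Q (Fin.append e₁ e₂) (Fin.append y₁ y₂) =
      Q₁ e₁ y₁ * Q₂ e₁ e₂ y₂ := by
    intro e₁ e₂ y₁ y₂
    simp only [Q, Fin.append_left, Fin.append_right]
  refine ⟨Q, fun e y => mul_nonneg (hQ₁ _ _) (hQ₂ _ _ _), fun e => ?_, fun i e y hy => ?_, ?_⟩
  · rw [sum_fin_add]
    simp only [Q, Fin.append_left, Fin.append_right, ← Finset.mul_sum]
    calc _ ≤ ∑ y, Q₁ (fun i => e (Fin.castAdd n i)) y * 1 :=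
          Finset.sum_le_sum fun y _ => mul_le_mul_of_nonneg_left (hQ₂1 _ _) (hQ₁ _ _)
      _ ≤ 1 := by simpa using hQ₁1 _
  · rw [← Fin.append_castAdd_natAdd (f := e), ← Fin.append_castAdd_natAdd (f := y),
      CausalFun.wordProb_run_append] at hy
    exact mul_pos (hpos₁ i _ _ (pos_of_mul_pos_left hy (ch.wordProb_nonneg _ _)))
      (hpos₂ _ i _ _ (pos_of_mul_pos_right hy (ch.wordProb_nonneg _ _)))
  · have hkl : ∀ e₁ e₂ i, klSum (ch.wordProb (ch.run (u i) (Fin.append e₁ e₂)))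
        (Q (Fin.append e₁ e₂)) =
        klSum (ch.wordProb (ch.run (CausalFun.take (u i)) e₁)) (Q₁ e₁) +
          klSum (ch.wordProb (ch.run (CausalFun.drop (u i) e₁) e₂)) (Q₂ e₁ e₂) := by
      intro e₁ e₂ i
      rw [klSum_append]
      simp only [CausalFun.wordProb_run_append, hQ]
      exact klSum_prod (ch.wordProb_nonneg _) (ch.wordProb_nonneg _) (ch.sum_wordProb _)
        (ch.sum_wordProb _) (fun y => hpos₁ i e₁ y) (fun y => hpos₂ e₁ i e₂ y)
    rw [sum_fin_add]
    simp only [hP, hkl, mul_add, Finset.sum_add_distrib]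
    refine add_le_add ?_ ?_
    · refine le_trans (le_of_eq ?_) hle₁
      refine Finset.sum_congr rfl fun e₁ _ => ?_
      rw [← Finset.sum_mul, ← Finset.mul_sum, hP₂, mul_one]
    · calc _ = ∑ e₁, P₁ e₁ * ∑ e₂, P₂ e₁ e₂ * ∑ i, w i *
            klSum (ch.wordProb (ch.run (CausalFun.drop (u i) e₁) e₂)) (Q₂ e₁ e₂) := by
            simp only [Finset.mul_sum, mul_assoc]
        _ ≤ ∑ e₁, P₁ e₁ * c₂ :=
            Finset.sum_le_sum fun e₁ _ => mul_le_mul_of_nonneg_left (hle₂ e₁) (hP₁ e₁)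
        _ = c₂ := by rw [← Finset.sum_mul, hP₁1, one_mul]

theorem redundancyLE_zero (P : (Fin 0 → ch.harvest) → ℝ) (u : I → ch.CausalFun 0) :
    RedundancyLE P w u 0 :=
  ⟨fun _ _ => 1, fun _ _ => zero_le_one, fun _ => by simp, fun _ _ _ _ => zero_lt_one, by
    simp [klSum, wordProb]⟩

/-- A crude bound, at most `log |𝒴|` per use, that holds for every law of the energies. It absorbs
the first `r` uses. -/
theorem redundancyLE_uniform (hw : ∀ i, 0 ≤ w i) (hw1 : ∑ i, w i = 1) {m : ℕ}
    {P : (Fin m → ch.harvest) → ℝ} (hP : ∀ e, 0 ≤ P e) (hP1 : ∑ e, P e = 1)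
    (u : I → ch.CausalFun m) : RedundancyLE P w u (m * Real.log (Fintype.card 𝒴)) := by
  have hY : 0 < (Fintype.card 𝒴 : ℝ) := by
    rcases isEmpty_or_nonempty 𝒴 with h | h
    · have := ch.sum_W 0
      simp at this
    · exact_mod_cast Fintype.card_pos
  refine ⟨fun _ _ => ((Fintype.card 𝒴 : ℝ) ^ m)⁻¹, fun _ _ => by positivity, fun _ => ?_,
    fun _ _ _ _ => by positivity, ?_⟩
  · simp [hY.ne']
  · have hkl : ∀ e i, klSum (ch.wordProb (ch.run (u i) e))
        (fun _ => ((Fintype.card 𝒴 : ℝ) ^ m)⁻¹) ≤ m * Real.log (Fintype.card 𝒴) := by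
      intro e i
      calc _ ≤ ∑ y, ch.wordProb (ch.run (u i) e) y * (m * Real.log (Fintype.card 𝒴)) := by
            refine Finset.sum_le_sum fun y _ => ?_
            rcases (ch.wordProb_nonneg (ch.run (u i) e) y).eq_or_lt with h | h
            · simp [← h]
            refine mul_le_mul_of_nonneg_left ?_ h.le
            rw [div_inv_eq_mul, ← Real.log_pow]
            refine Real.log_le_log (by positivity) ?_
            exact mul_le_of_le_one_left (by positivity) (ch.wordProb_le_one _ _)
        _ = _ := by rw [← Finset.sum_mul, ch.sum_wordProb, one_mul]
    calc _ ≤ ∑ e, P e * ∑ i, w i * (m * Real.log (Fintype.card 𝒴)) :=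
          Finset.sum_le_sum fun e _ => mul_le_mul_of_nonneg_left
            (Finset.sum_le_sum fun i _ => mul_le_mul_of_nonneg_left (hkl e i) (hw i)) (hP e)
      _ = _ := by rw [← Finset.sum_mul, hP1, ← Finset.sum_mul, hw1, one_mul, one_mul]

variable [Fintype 𝒳]

theorem redundancyLE_block [Nonempty ch.harvest] (hK : ch.IsHarvestKernel K)
    (hw : ∀ i, 0 < w i) (hw1 : ∑ i, w i = 1) {N : ℕ} (hN : 1 ≤ N) (h : Fin r → ch.harvest)
    {u : I → ch.CausalFun N} (hu : ∀ i, CausalFun.IsLegal (u i)) :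
    RedundancyLE (ch.harvestProb K h) w u (N * ch.barC K N) := by
  classical
  let V : (Fin N → ch.harvest) → I → (Fin N → 𝒴) → ℝ := fun e i => ch.wordProb (ch.run (u i) e)
  have hV : ∀ e i y, 0 ≤ V e i y := fun e i y => ch.wordProb_nonneg _ _
  refine ⟨fun e => mixLaw w (V e), fun e => mixLaw_nonneg (fun i => (hw i).le) (hV e),
    fun e => (sum_mixLaw hw1 fun i => ch.sum_wordProb _).le,
    fun i e y hy => mixLaw_pos (fun i => (hw i).le) (hV e) (hw i) hy, ?_⟩
  let φ : I → ch.InputFun N := fun i => CausalFun.toInputFun (u i) (hu i)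
  -- The image of `w`, since different indices may yield the same input function. With the mixture
  -- as reference law the average relative entropy is exactly the block information of `PU`.
  let PU : ch.InputFun N → ℝ := fun a => ∑ i with φ i = a, w i
  have hPU : PU ∈ stdSimplex ℝ (ch.InputFun N) :=
    ⟨fun a => Finset.sum_nonneg fun i _ => (hw i).le, by
      simpa [PU, hw1] using sum_mul_comp_eq (w := w) φ fun _ => 1⟩
  have hφ : ∀ i e, ch.outputProb (φ i) ch.fullBattery e = V e i := fun i e =>
    funext fun y => CausalFun.outputProb_toInputFun (u i) (hu i) e y
  have hmix : ∀ e, mixLaw PU (fun a => ch.outputProb a ch.fullBattery e) = mixLaw w (V e) := by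
    intro e
    funext y
    simp only [mixLaw, PU]
    rw [sum_mul_comp_eq φ fun a => ch.outputProb a ch.fullBattery e y]
    simp only [hφ]
  have hinfo : ch.blockInfo K PU h =
      ∑ e, ch.harvestProb K h e * ∑ i, w i * klSum (V e i) (mixLaw w (V e)) := by
    rw [blockInfo_eq hK hPU]
    refine Finset.sum_congr rfl fun e _ => ?_
    rw [hmix]
    simp only [PU]
    rw [sum_mul_comp_eq φ fun a =>
      klSum (ch.outputProb a ch.fullBattery e) (mixLaw w (V e))]
    simp only [hφ]
  have hle : 1 / (N : ℝ) * ch.blockInfo K PU h ≤ ch.barC K N :=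
    (isGreatest_barC hK N).2 ⟨PU, hPU, h, rfl⟩
  have hN' : (0 : ℝ) < N := by exact_mod_cast hN
  rw [← hinfo]
  rwa [one_div, inv_mul_le_iff₀ hN'] at hle

/-- Induction on the number of blocks, each restarted from its own history; `barC` covers all
histories by its maximum. -/
theorem redundancyLE_blocks [Nonempty ch.harvest] (hK : ch.IsHarvestKernel K)
    (hS : ∀ e : ch.harvest, Monotone fun b : ch.Battery => ch.S b e)
    (hw : ∀ i, 0 < w i) (hw1 : ∑ i, w i = 1) {N : ℕ} (hN : 1 ≤ N) (k : ℕ) {T : ℕ} (hT : T = k * N)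
    (h : Fin r → ch.harvest) {u : I → ch.CausalFun T} (hu : ∀ i, CausalFun.IsLegal (u i)) :
    RedundancyLE (ch.harvestProb K h) w u (k * (N * ch.barC K N)) := by
  induction k generalizing T h with
  | zero =>
    obtain rfl : T = 0 := by simpa using hT
    simpa using redundancyLE_zero (ch.harvestProb K h) u
  | succ k ih =>
    obtain rfl : T = N + k * N := by rw [hT]; ring
    have := RedundancyLE.append (fun e₁ e₂ => harvestProb_append h e₁ e₂)
      (harvestProb_nonneg hK h) (sum_harvestProb hK h) (fun e => sum_harvestProb hK _)
      (redundancyLE_block hK hw hw1 hN h fun i => (hu i).take)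
      (fun e => ih rfl (ch.lastWindow h e) fun i => (hu i).drop hS e)
    convert this using 1
    push_cast
    ring

end

/-! ### The law of the harvested energies -/

section
variable {Ω : Type*} [MeasurableSpace Ω] {P : Measure Ω} {E : ℕ → Ω → ch.harvest} {r : ℕ}
  {K : (Fin r → ch.harvest) → ch.harvest → ℝ}

theorem IsMarkovOfOrder.prob_eq_prod (hK : ch.IsMarkovOfOrder P E r K) (T : ℕ)
    (e : ℕ → ch.harvest) :
    P.real {ω | ∀ i < T + r, E i ω = e i} = P.real {ω | ∀ i < r, E i ω = e i} *
      ∏ n ∈ Finset.range T, K (fun i => e (n + i.val)) (e (n + r)) := by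
  induction T with
  | zero => simp
  | succ T ih =>
    rw [Finset.prod_range_succ, ← mul_assoc, ← ih, ← hK.2 T e, Nat.add_right_comm]

theorem IsMarkovOfOrder.prob_append [Nonempty ch.harvest] (hK : ch.IsMarkovOfOrder P E r K) {T : ℕ}
    (e₁ : Fin r → ch.harvest) (e₂ : Fin T → ch.harvest) :
    P.real {ω | ∀ i : Fin (r + T), E i ω = Fin.append e₁ e₂ i} =
      P.real {ω | ∀ i : Fin r, E i ω = e₁ i} * ch.harvestProb K e₁ e₂ := by
  classical
  -- The Markov property is stated for infinite sequences; the arbitrary values beyond `r + T` are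
  -- never read.
  let a : ℕ → ch.harvest := fun k =>
    if h : k < r + T then Fin.append e₁ e₂ ⟨k, h⟩ else Classical.arbitrary _
  have ha : ∀ k (h : k < r + T), a k = Fin.append e₁ e₂ ⟨k, h⟩ := fun k h => dif_pos h
  have h := hK.prob_eq_prod T a
  have h1 : {ω | ∀ i : Fin (r + T), E i ω = Fin.append e₁ e₂ i} =
      {ω | ∀ i < T + r, E i ω = a i} := by
    ext ω
    refine ⟨fun h i hi => ?_, fun h i => ?_⟩
    · rw [ha i (by omega)]
      exact h ⟨i, by omega⟩
    · have := h i.val (by omega)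
      rwa [ha i.val i.2] at this
  have h2 : {ω | ∀ i : Fin r, E i ω = e₁ i} = {ω | ∀ i < r, E i ω = a i} := by
    ext ω
    refine ⟨fun h i hi => ?_, fun h i => ?_⟩
    · rw [ha i (by omega), append_apply, dif_pos hi]
      exact h ⟨i, hi⟩
    · have := h i.val i.2
      rwa [ha i.val (by omega), append_apply, dif_pos i.2] at this
  rw [h1, h2, h, harvestProb, ← Fin.prod_univ_eq_prod_range
    (fun n => K (fun i => a (n + i.val)) (a (n + r)))]
  congr 1
  refine Finset.prod_congr rfl fun n _ => ?_
  have h3 : (fun i : Fin r => a (n.val + i.val)) = ch.window e₁ e₂ n :=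
    funext fun i => ha _ (by omega)
  have h4 : a (n.val + r) = e₂ n := by
    rw [ha _ (by omega), append_apply, dif_neg (by omega)]
    congr 1
    ext
    simp
  rw [h3, h4]

theorem sum_prob_eq_one [IsProbabilityMeasure P] (hE : ∀ n, Measurable (E n)) (L : ℕ) :
    ∑ e : Fin L → ch.harvest, P.real {ω | ∀ i : Fin L, E i ω = e i} = 1 := by
  have hm : Measurable fun ω => fun i : Fin L => E i ω := measurable_pi_lambda _ fun i => hE i
  have h := sum_measureReal_preimage_singleton (μ := P) (Finset.univ : Finset (Fin L → ch.harvest))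
    (f := fun ω => fun i : Fin L => E i ω) (fun e _ => hm (measurableSet_singleton e))
  rw [Finset.coe_univ, Set.preimage_univ, probReal_univ] at h
  rw [← h]
  refine Finset.sum_congr rfl fun e _ => ?_
  congr 1
  ext ω
  simp [funext_iff]

theorem sum_prob_battery_eq_one [IsProbabilityMeasure P] {B₁ : Ω → ch.Battery}
    (hB₁ : Measurable B₁) : ∑ b, P.real {ω | B₁ ω = b} = 1 := by
  have h := sum_measureReal_preimage_singleton (μ := P) (Finset.univ : Finset ch.Battery)
    (f := B₁) (fun e _ => hB₁ (measurableSet_singleton e))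
  rw [Finset.coe_univ, Set.preimage_univ, probReal_univ] at h
  exact h

theorem prob_battery_inter {B₁ : Ω → ch.Battery} (hindep : IndepFun B₁ (fun ω n => E n ω) P)
    {L : ℕ} (b : ch.Battery) (e : Fin L → ch.harvest) :
    P.real {ω | B₁ ω = b ∧ ∀ i : Fin L, E i ω = e i} =
      P.real {ω | B₁ ω = b} * P.real {ω | ∀ i : Fin L, E i ω = e i} := by
  have h := hindep.measure_inter_preimage_eq_mul {b} {f | ∀ i : Fin L, f i = e i}
    (measurableSet_singleton b) (by
      rw [Set.ofPred_forall]
      exact MeasurableSet.iInter fun i => measurableSet_eq_fun (measurable_pi_apply _)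
        measurable_const)
  simp only [Measure.real, ← ENNReal.toReal_mul]
  exact congrArg ENNReal.toReal h

end

end EHChannel

namespace EHChannel

variable {𝒳 𝒴 : Type*} [Zero 𝒳] [Fintype 𝒳] [Fintype 𝒴] {ch : EHChannel 𝒳 𝒴}

/-! ### The converse -/

section
variable {Ω : Type*} [MeasurableSpace Ω] {P : Measure Ω} {B₁ : Ω → ch.Battery}
  {E : ℕ → Ω → ch.harvest} {r : ℕ} {K : (Fin r → ch.harvest) → ch.harvest → ℝ}

/-- A bound for the number of messages of a code of block length `r + k N`. -/
theorem log_card_le_of_errorProb_le [Nonempty ch.harvest] [IsProbabilityMeasure P]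
    (hS : ∀ e : ch.harvest, Monotone fun b : ch.Battery => ch.S b e)
    (hB₁ : Measurable B₁) (hE : ∀ n, Measurable (E n))
    (hindep : IndepFun B₁ (fun ω n => E n ω) P) (hK : ch.IsMarkovOfOrder P E r K)
    {N : ℕ} (hN : 1 ≤ N) (k : ℕ) {M : ℕ} (hM : 0 < M) {ε : ℝ}
    (f : Fin M → ch.InputFun (r + k * N)) (g : (Fin (r + k * N) → 𝒴) → Fin M)
    (herr : ∀ m, ch.errorProb P B₁ E f g m ≤ ε) :
    (1 - ε) * Real.log M ≤
      k * (N * ch.barC K N) + (r * Real.log (Fintype.card 𝒴) + Real.log 2) := by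
  classical
  have hM' : (0 : ℝ) < M := by exact_mod_cast hM
  let L := r + k * N
  let PE : (Fin L → ch.harvest) → ℝ := fun e => P.real {ω | ∀ i : Fin L, E i ω = e i}
  let PB : ch.Battery → ℝ := fun b => P.real {ω | B₁ ω = b}
  have hPE1 : ∑ e, PE e = 1 := sum_prob_eq_one hE L
  have hPB1 : ∑ b, PB b = 1 := sum_prob_battery_eq_one hB₁
  let w : Fin M → ℝ := fun _ => 1 / (M : ℝ)
  have hw : ∀ m, 0 < w m := fun m => by positivity
  have hw1 : ∑ m, w m = 1 := by simp [w, hM'.ne']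
  let u : ch.Battery → Fin M → ch.CausalFun L := fun b m n => (f m).1 n b
  have hu : ∀ b m, CausalFun.IsLegal (u b m) := fun b m e => ((f m).2 b e).full hS
  let perr : ch.Battery → (Fin L → ch.harvest) → ℝ := fun b e =>
    ∑ m, 1 / (M : ℝ) * ∑ y with g y ≠ m, ch.wordProb (ch.run (u b m) e) y
  have hred : ∀ b, RedundancyLE PE w (u b)
      (r * Real.log (Fintype.card 𝒴) + k * (N * ch.barC K N)) := fun b =>
    RedundancyLE.append (fun e₁ e₂ => hK.prob_append e₁ e₂) (fun e => measureReal_nonneg)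
      (sum_prob_eq_one hE r) (fun e => sum_harvestProb hK.1 e)
      (redundancyLE_uniform (fun m => (hw m).le) hw1 (fun e => measureReal_nonneg)
        (sum_prob_eq_one hE r) _)
      (fun e => redundancyLE_blocks hK.1 hS hw hw1 hN k rfl e fun m => (hu b m).drop hS e)
  -- The converse is applied for each initial level and energy sequence separately, as if the
  -- decoder's comparison law knew both. It is linear in the error probability, so it can then be
  -- averaged.
  have hb : ∀ b, Real.log M - Real.log 2 - Real.log M * ∑ e, PE e * perr b e ≤
      r * Real.log (Fintype.card 𝒴) + k * (N * ch.barC K N) := by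
    intro b
    obtain ⟨Q, hQ, hQ1, hpos, hle⟩ := hred b
    refine le_trans ?_ hle
    calc Real.log M - Real.log 2 - Real.log M * ∑ e, PE e * perr b e
        = ∑ e, PE e * ((1 - perr b e) * Real.log M - Real.log 2) := by
          have : ∀ e, PE e * ((1 - perr b e) * Real.log M - Real.log 2) =
              PE e * (Real.log M - Real.log 2) - Real.log M * (PE e * perr b e) :=
            fun e => by ring
          simp only [this, Finset.sum_sub_distrib, ← Finset.sum_mul, ← Finset.mul_sum, hPE1]
          ring
      _ ≤ _ := Finset.sum_le_sum fun e _ => mul_le_mul_of_nonneg_left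
          (log_card_le_klSum hM g (fun m => ch.wordProb_nonneg _) (fun m => ch.sum_wordProb _)
            (hQ e) (hQ1 e) fun m y => hpos m e y) measureReal_nonneg
  have havg : ∑ b, PB b * ∑ e, PE e * perr b e ≤ ε := by
    have h1 : ∑ b, PB b * ∑ e, PE e * perr b e =
        ∑ m, 1 / (M : ℝ) * ch.errorProb P B₁ E f g m := by
      have h2 : ∀ m, ch.errorProb P B₁ E f g m = ∑ b, ∑ e, PB b * PE e *
          ∑ y with g y ≠ m, ch.wordProb (ch.run (u b m) e) y := fun m => by
        simp only [errorProb, prob_battery_inter hindep]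
        rfl
      simp only [h2, perr, Finset.mul_sum (s := (Finset.univ : Finset ch.Battery)),
        Finset.mul_sum (s := (Finset.univ : Finset (Fin L → ch.harvest))),
        Finset.mul_sum (s := (Finset.univ : Finset (Fin M)))]
      rw [Finset.sum_comm (s := (Finset.univ : Finset (Fin M)))]
      refine Finset.sum_congr rfl fun b _ => ?_
      rw [Finset.sum_comm (s := (Finset.univ : Finset (Fin M)))]
      refine Finset.sum_congr rfl fun e _ => Finset.sum_congr rfl fun m _ => ?_
      ring
    rw [h1]
    calc _ ≤ ∑ m : Fin M, 1 / (M : ℝ) * ε :=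
          Finset.sum_le_sum fun m _ => mul_le_mul_of_nonneg_left (herr m) (by positivity)
      _ = ε := by simp [hM'.ne']
  have hPB : ∀ b, 0 ≤ PB b := fun b => measureReal_nonneg
  have hsum := Finset.sum_le_sum fun b (_ : b ∈ Finset.univ) =>
    mul_le_mul_of_nonneg_left (hb b) (hPB b)
  have h3 : ∀ b, PB b * (Real.log M - Real.log 2 - Real.log M * ∑ e, PE e * perr b e) =
      PB b * (Real.log M - Real.log 2) - Real.log M * (PB b * ∑ e, PE e * perr b e) :=
    fun b => by ring
  simp only [h3, Finset.sum_sub_distrib] at hsum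
  rw [← Finset.sum_mul, ← Finset.sum_mul, ← Finset.mul_sum, hPB1, one_mul, one_mul] at hsum
  have hlog : 0 ≤ Real.log M := Real.log_natCast_nonneg M
  nlinarith [mul_le_mul_of_nonneg_left havg hlog]

theorem le_of_eventually_affine_le {a b c d : ℝ}
    (h : ∀ᶠ k : ℕ in atTop, a * k + b ≤ c * k + d) : a ≤ c := by
  by_contra! hac
  have hlim : Tendsto (fun k : ℕ => (a - c) * (k : ℝ)) atTop atTop :=
    tendsto_natCast_atTop_atTop.const_mul_atTop (sub_pos.2 hac)
  obtain ⟨k, hk1, hk2⟩ := (h.and (hlim.eventually_gt_atTop (d - b))).exists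
  nlinarith

/-- Only the block lengths `r + k * N` are tested. Both sides of the converse are affine in `k`, so
comparing slopes removes the cost of the first `r` uses and the `log 2`. -/
theorem Achievable.le_barC [Nonempty ch.harvest] [IsProbabilityMeasure P]
    (hS : ∀ e : ch.harvest, Monotone fun b : ch.Battery => ch.S b e)
    (hB₁ : Measurable B₁) (hE : ∀ n, Measurable (E n))
    (hindep : IndepFun B₁ (fun ω n => E n ω) P) (hK : ch.IsMarkovOfOrder P E r K)
    {N : ℕ} (hN : 1 ≤ N) {R : ℝ} (hR : ch.Achievable P B₁ E R) : R ≤ ch.barC K N := by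
  have hN' : (0 : ℝ) < N := by exact_mod_cast hN
  have key : ∀ ε : ℝ, 0 < ε → ε < 1 → (1 - ε) * R ≤ ch.barC K N := by
    intro ε h0 h1
    have hlen : Tendsto (fun k : ℕ => r + k * N) atTop atTop :=
      tendsto_atTop_mono (fun k => (Nat.le_mul_of_pos_right k hN).trans (Nat.le_add_left _ _))
        tendsto_id
    have h2 : ∀ᶠ k : ℕ in atTop, (N * ((1 - ε) * R)) * (k : ℝ) + (1 - ε) * (r * R) ≤
        (N * ch.barC K N) * k + (r * Real.log (Fintype.card 𝒴) + Real.log 2) := by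
      filter_upwards [hlen.eventually (hR ε h0)] with k ⟨f, g, hfg⟩
      have hexp := Real.exp_pos (((r + k * N : ℕ) : ℝ) * R)
      have h3 := log_card_le_of_errorProb_le hS hB₁ hE hindep hK hN k (Nat.ceil_pos.2 hexp) f g
        fun m => (hfg m).le
      have h4 : ((r + k * N : ℕ) : ℝ) * R ≤
          Real.log (⌈Real.exp (((r + k * N : ℕ) : ℝ) * R)⌉₊ : ℝ) := by
        rw [Real.le_log_iff_exp_le (by exact_mod_cast Nat.ceil_pos.2 hexp)]
        exact Nat.le_ceil _
      have h5 := mul_le_mul_of_nonneg_left h4 (sub_nonneg.2 h1.le)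
      push_cast at h3 h5
      nlinarith
    exact le_of_mul_le_mul_left (le_of_eventually_affine_le h2) hN'
  have hlim : Tendsto (fun ε : ℝ => (1 - ε) * R) (nhdsWithin 0 (Set.Ioi 0)) (nhds R) := by
    have : Continuous fun ε : ℝ => (1 - ε) * R := by fun_prop
    have h := (this.tendsto 0).mono_left (nhdsWithin_le_nhds (s := Set.Ioi 0))
    simpa using h
  refine le_of_tendsto hlim ?_
  filter_upwards [Ioo_mem_nhdsGT (zero_lt_one (α := ℝ))] with ε hε
  exact key ε hε.1 hε.2

end

end EHChannel

theorem mainTheorem8 {𝒳 𝒴 : Type*} [Zero 𝒳] [Fintype 𝒳] [Fintype 𝒴] (ch : EHChannel 𝒳 𝒴)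
    (hS : ∀ e : ch.harvest, Monotone fun b : ch.Battery => ch.S b e)
    {Ω : Type*} [MeasurableSpace Ω] (P : Measure Ω) [IsProbabilityMeasure P]
    (B₁ : Ω → ch.Battery) (hB₁ : Measurable B₁)
    (E : ℕ → Ω → ch.harvest) (hE : ∀ n, Measurable (E n))
    (hindep : IndepFun B₁ (fun ω n => E n ω) P)
    (r : ℕ) (K : (Fin r → ch.harvest) → ch.harvest → ℝ) (hK : ch.IsMarkovOfOrder P E r K)
    (N : ℕ) (hN : 1 ≤ N) :
    IsGreatest (ch.barSet K N) (ch.barC K N) ∧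
    (∀ π ∈ stdSimplex ℝ (ch.State r), IsGreatest (ch.tildeSet K N π) (ch.tildec K N π)) ∧
    ch.barC K N ≤ ch.tildeC K N ∧
    ch.capacity P B₁ E ≤ (ch.tildeC K N : EReal) := by
  obtain ⟨ω⟩ : Nonempty Ω := nonempty_of_isProbabilityMeasure P
  have : Nonempty ch.harvest := ⟨E 0 ω⟩
  have hle := EHChannel.barC_le_tildeC (ch := ch) hK.1 N
  refine ⟨EHChannel.isGreatest_barC hK.1 N, fun π hπ => EHChannel.isGreatest_tildec hK.1 N hπ.1,
    hle, sSup_le ?_⟩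
  rintro _ ⟨R, hR, rfl⟩
  exact EReal.coe_le_coe_iff.2
    ((EHChannel.Achievable.le_barC hS hB₁ hE hindep hK hN hR).trans hle)
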